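/- Let $d,p\in\mathbb N$ and let $\mathcal X=\mathcal S\times\mathcal A\subset\mathbb R^p$ be a compact set of state-action pairs. Put $\overline{\mathcal X}=\mathcal X\times\{1,\dots,d\}$ and let $k:\overline{\mathcal X}\times\overline{\mathcal X}\to\mathbb R$ be a continuous positive (semi)definite kernel with $k\le 1$ and reproducing kernel Hilbert space $\mathcal H$. Let $\tilde f\in\mathcal H$ with $\|\tilde f\|_{\mathcal H}\le B$, where $B>0$, and $f(s,a)=(\tilde f(s,a,1),\dots,\tilde f(s,a,d))\in\mathbb R^d$. A query of $(s_i,a_i)$ returns $y_i=f(s_i,a_i)+\omega_i$, where $\omega_1,\omega_2,\dots$ are independent and $\mathcal N(0,\sigma^2I_d)$-distributed, $\sigma>0$. Let $\lambda>0$. After $n$ queries $x_i=(s_i,a_i)$, let $K_{nd}=[k((x_i,l),(x_j,l'))]$ be the $nd\times nd$ covariance matrix, $k_{nd}(z)=[k(z,(x_i,l))]_{i,l}$ and $y_{nd}=[y_{i,l}]_{i,l}$; for $z\in\overline{\mathcal X}$ put $$\mu_{nd}(z)=k_{nd}(z)(K_{nd}+\lambda I)^{-1}y_{nd},\qquad \sigma_{nd}^2(z)=k(z,z)-k_{nd}(z)(K_{nd}+\lambda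 I)^{-1}k_{nd}(z)^T,$$ $\mu_n(s,a)=(\mu_{nd}(s,a,l))_{l\le d}$, $\sigma_n(s,a)=(\sigma_{nd}(s,a,l))_{l\le d}$ for $n\ge1$, and $\sigma_0\equiv(1,\dots,1)$. The maximum variance reduction (MVR) algorithm queries, for $i=1,\dots,n$, a pair $(s_i,a_i)\in\arg\max_{(s,a)\in\mathcal X}\|\sigma_{i-1}(s,a)\|_2$, with ties broken independently of the observations (the queries are a non-random sequence), and outputs $\mu_n$. Let $$\Gamma_{m}=\max_{z_1,\dots,z_{m}\in\overline{\mathcal X}}\tfrac12\log\det\big(I_{m}+\lambda^{-1}[k(z_i,z_j)]_{i,j\le m}\big).$$ Discretization assumption, with constant $C$: for every $n\ge1$ and every $b\ge B$ there is a finite set $\mathcal D\subset\mathcal X$ with $|\mathcal D|\le C\,b^{p}n^{p/2}$ and a choice $[s,a]\in\mathcal D$ of a Euclidean-nearest point of $\mathcal D$ to each $(s,a)\in\mathcal X$, such that $g(s,a,i)-g([s,a],i)\le 1/\sqrt n$ for all $g\in\mathcal H$ with $\|g\|_{\mathcal H}\le b$, all $(s,a)\in\mathcal X$ and all $i\le d$.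 Put $\beta(\delta)=B+\frac{\sigma}{\lambda}\sqrt{2\log(2/\delta)}$ and $$\beta_n(\delta)=2B+\beta\left(\frac{\delta}{3C\,\big(B+\sqrt n\,\beta(\tfrac{2\delta}{3n})\big)^{p}\,n^{p/2}}\right).$$ Then there is a constant $K>0$, depending only on $\lambda$ and $B$, such that under the above assumptions, for all $n\ge1$ and $\delta\in(0,1)$, with probability at least $1-\delta$, simultaneously for all $(s,a)\in\mathcal S\times\mathcal A$, $$\|\mu_n(s,a)-f(s,a)\|_2\le K\cdot\frac{\beta_n(\delta)\,2ed}{\sqrt n}\sqrt{\Gamma_{nd}}.$$ -/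

import Mathlib

open MeasureTheory ProbabilityTheory
open scoped Matrix

namespace MVR

noncomputable section

/-! ### Reproducing kernel Hilbert space -/

/-- `H` is the reproducing kernel Hilbert space of the scalar kernel `k` on `Z`: the kernel of
the Hilbert function space `H` (in particular `⟪g, k(z, ·)⟫ = g z` for `g : H`) is `k`. -/
def IsRKHSOf {Z : Type*} (k : Z → Z → ℝ) (H : Type*) [NormedAddCommGroup H]
    [InnerProductSpace ℝ H] [CompleteSpace H] [RKHS ℝ H Z ℝ] : Prop :=
  ∀ z w : Z, RKHS.kernel H z w (1 : ℝ) = k z w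

/-! ### Multi-output Gaussian process posterior

Inputs are pairs `(x, l)` of a state-action pair `x : X` and an output index `l : Fin d`.  After
`n` queries `x 0, …, x (n-1)`, each one returning all `d` output coordinates, the data set is
indexed by `Fin n × Fin d`. -/

section Posterior

variable {X : Type*} {d : ℕ}

/-- The `nd × nd` covariance matrix `K_{nd}` of the first `n` queries. -/
def gram (k : X × Fin d → X × Fin d → ℝ) (x : ℕ → X) (n : ℕ) :
    Matrix (Fin n × Fin d) (Fin n × Fin d) ℝ :=
  Matrix.of fun a b => k (x a.1, a.2) (x b.1, b.2)

/-- The covariance vector `k_{nd}(z)`. -/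
def kvec (k : X × Fin d → X × Fin d → ℝ) (x : ℕ → X) (n : ℕ) (z : X × Fin d) :
    Fin n × Fin d → ℝ :=
  fun a => k z (x a.1, a.2)

/-- The posterior mean `μ_n(s,a) = (μ_{nd}(s,a,1), …, μ_{nd}(s,a,d))`, where
`μ_{nd}(z) = k_{nd}(z) (K_{nd} + λ I)⁻¹ y_{nd}` and `y t` is the outcome of query `t`. -/
def postMean (k : X × Fin d → X × Fin d → ℝ) (lam : ℝ) (x : ℕ → X)
    (y : ℕ → EuclideanSpace ℝ (Fin d)) (n : ℕ) (u : X) : EuclideanSpace ℝ (Fin d) :=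
  WithLp.toLp 2 fun l =>
    kvec k x n (u, l) ⬝ᵥ ((gram k x n + lam • 1)⁻¹ *ᵥ fun a : Fin n × Fin d => y a.1 a.2)

/-- The posterior covariance `k(z,w) - k_{nd}(z) (K_{nd} + λ I)⁻¹ k_{nd}(w)ᵀ`. -/
def postCov (k : X × Fin d → X × Fin d → ℝ) (lam : ℝ) (x : ℕ → X) (n : ℕ)
    (z w : X × Fin d) : ℝ :=
  k z w - kvec k x n z ⬝ᵥ ((gram k x n + lam • 1)⁻¹ *ᵥ kvec k x n w)

/-- The posterior standard deviation vector `σ_n(s,a) = (σ_{nd}(s,a,1), …, σ_{nd}(s,a,d))`. -/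
def postSd (k : X × Fin d → X × Fin d → ℝ) (lam : ℝ) (x : ℕ → X) (n : ℕ) (u : X) :
    EuclideanSpace ℝ (Fin d) :=
  WithLp.toLp 2 fun l => √(postCov k lam x n (u, l) (u, l))

/-- The standard deviation vector which the algorithm uses after `t` queries: it is initialised
with `σ_0 = 1` at all state-action pairs, and is the posterior one from then on. -/
def algSd (k : X × Fin d → X × Fin d → ℝ) (lam : ℝ) (x : ℕ → X) : ℕ → X →
    EuclideanSpace ℝ (Fin d)
  | 0, _ => WithLp.toLp 2 fun _ => 1
  | t + 1, u => postSd k lam x (t + 1) u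

/-- `x 0, …, x (n-1)` are the queries of a run of `n` steps of the maximum variance reduction
algorithm: each query maximises the Euclidean norm of the current standard deviation vector
over all state-action pairs (ties may be broken in any way). -/
def IsMVRRun (k : X × Fin d → X × Fin d → ℝ) (lam : ℝ) (n : ℕ) (x : ℕ → X) : Prop :=
  ∀ t < n, ∀ u : X, ‖algSd k lam x t u‖ ≤ ‖algSd k lam x t (x t)‖

end Posterior

/-- The maximum information gain
`Γ_m = max_{z_1, …, z_m} (1/2) log det (I_m + λ⁻¹ K_m)`, `K_m = [k(z_i, z_j)]`. -/
def maxInfoGain {Z : Type*} (k : Z → Z → ℝ) (lam : ℝ) (m : ℕ) : ℝ :=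
  ⨆ z : Fin m → Z,
    (1 / 2 : ℝ) *
      Real.log (1 + lam⁻¹ • (Matrix.of fun i j => k (z i) (z j) : Matrix (Fin m) (Fin m) ℝ)).det

/-! ### Confidence parameters -/

/-- `β(δ) = B + (σ / λ) √(2 log (2 / δ))`. -/
def beta (B σ lam δ : ℝ) : ℝ :=
  B + σ / lam * √(2 * Real.log (2 / δ))

/-- `β_n(δ) = 2B + β(δ / (3 C (B + √n β(2δ / (3n)))^p n^{p/2}))`, with `p` the dimension of the
space that contains the state-action pairs. -/
def betaN (B σ lam C : ℝ) (p n : ℕ) (δ : ℝ) : ℝ :=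
  2 * B + beta B σ lam
    (δ / (3 * C * (B + √(n : ℝ) * beta B σ lam (2 * δ / (3 * n))) ^ p * (n : ℝ) ^ ((p : ℝ) / 2)))

/-! ### Discretization assumption -/

/-- For every `n ≥ 1` and every RKHS norm bound `b ≥ B` there is a finite set `D` of at most
`C b^p n^{p/2}` state-action pairs such that every function of norm at most `b` changes by at
most `1/√n` (in every output coordinate) when a state-action pair `u` is replaced by a nearest
point `r u = [u]_n` of `D`.  The constant `C` depends neither on `n` nor on `b`. -/
def Discretizable {p d : ℕ} (X : Set (EuclideanSpace ℝ (Fin p))) (H : Type*)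
    [NormedAddCommGroup H] [InnerProductSpace ℝ H] [RKHS ℝ H (X × Fin d) ℝ]
    (C B : ℝ) : Prop :=
  ∀ n : ℕ, 1 ≤ n → ∀ b : ℝ, B ≤ b → ∃ (D : Finset X) (r : X → X),
    (D.card : ℝ) ≤ C * b ^ p * (n : ℝ) ^ ((p : ℝ) / 2) ∧
    (∀ u : X, r u ∈ D ∧ ∀ v ∈ D, dist u (r u) ≤ dist u v) ∧
    ∀ g : H, ‖g‖ ≤ b → ∀ (u : X) (i : Fin d), g (u, i) - g (r u, i) ≤ 1 / √(n : ℝ)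

end

end MVR

/-! Write `k` as the Gram kernel of a feature map `φ` into the Hilbert space. The posterior mean is
then kernel ridge regression, and the posterior variance at `z` is the minimum over coefficient
vectors `c` of `‖φ z - Σ c_a φ_a‖² + λ|c|²`, attained at the ridge coefficients `α` of `z`
(`postCov_eq`, `postCov_le`). Hence the variance decreases with more queries, the bias at `z` is at
most `‖F‖` times the standard deviation, and the noise contributes `α ⬝ᵥ v` with `λ|α|²` at most the
variance. The queries being non-random, `α` is deterministic and `α ⬝ᵥ v` is a centred Gaussian, so
a union bound controls it at the finitely many points of a discretization.

To pass from these points to all of `X`, the error is viewed as one random element of the Hilbert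
space (`errorVec`). Its noise part has squared norm at most `λ⁻² vᵀKv`, where `K` is the Gram
matrix; factoring `K = AᴴA` turns this into `nd` further Gaussian statistics, so with high
probability the error lies in a fixed ball and the discretization assumption applies to it. Each of
the two events is allotted `δ/2`.

The variances decay because each query after the first maximises their sum over outputs: the final
value is at most each one met on the way, and Schur complements bound the logarithms of those by
`2Γ` (`sum_log_le_log_det`, `IsMVRRun.sum_postCov_le`).

The discretization error `√d/√n` must also be dominated by the rate, which needs a lower bound on
`Γ`. With `κ = max k(z,z)`, repeating a maximiser gives `2Γ ≥ log (1 + ndκ/λ)`, enough if `ndκ ≥ 1`.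
If `ndκ ≤ 1`, the norm bound on the error and Cauchy-Schwarz already suffice. The case `p = 0` is
separate: there `X` has at most one point and nothing is discretized. -/

namespace MVR

/-! ### Kernel ridge regression in feature space -/

section Features

open scoped InnerProductSpace

variable {X : Type*} {d : ℕ} {E : Type*} [NormedAddCommGroup E] [InnerProductSpace ℝ E]

/-- The linear combination of the features of the first `n` queries with coefficients `c`. -/
noncomputable def featureSum (φ : X × Fin d → E) (x : ℕ → X) (n : ℕ) (c : Fin n × Fin d → ℝ) : E :=
  ∑ a, c a • φ (x a.1, a.2)

/-- The kernel regression coefficients `(K_{nd} + λ I)⁻¹ v`. -/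
noncomputable def ridge (k : X × Fin d → X × Fin d → ℝ) (lam : ℝ) (x : ℕ → X) (n : ℕ)
    (v : Fin n × Fin d → ℝ) : Fin n × Fin d → ℝ :=
  (gram k x n + lam • 1)⁻¹ *ᵥ v

variable {k : X × Fin d → X × Fin d → ℝ} {φ : X × Fin d → E} {lam : ℝ}

lemma featureSum_add (x : ℕ → X) (n : ℕ) (c c' : Fin n × Fin d → ℝ) :
    featureSum φ x n (c + c') = featureSum φ x n c + featureSum φ x n c' := by
  simp [featureSum, add_smul, Finset.sum_add_distrib]

lemma inner_featureSum_right (g : E) (x : ℕ → X) (n : ℕ) (c : Fin n × Fin d → ℝ) :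
    ⟪g, featureSum φ x n c⟫_ℝ = (fun a : Fin n × Fin d => ⟪g, φ (x a.1, a.2)⟫_ℝ) ⬝ᵥ c := by
  simp [featureSum, inner_sum, inner_smul_right, dotProduct, mul_comm]

lemma inner_feature_featureSum (hφ : ∀ z w, ⟪φ z, φ w⟫_ℝ = k z w) (x : ℕ → X) (n : ℕ)
    (z : X × Fin d) (c : Fin n × Fin d → ℝ) :
    ⟪φ z, featureSum φ x n c⟫_ℝ = kvec k x n z ⬝ᵥ c := by
  rw [inner_featureSum_right]
  simp only [hφ]
  rfl

lemma inner_featureSum_featureSum (hφ : ∀ z w, ⟪φ z, φ w⟫_ℝ = k z w) (x : ℕ → X) (n : ℕ)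
    (c c' : Fin n × Fin d → ℝ) :
    ⟪featureSum φ x n c, featureSum φ x n c'⟫_ℝ = c ⬝ᵥ gram k x n *ᵥ c' := by
  conv_lhs => rw [featureSum, sum_inner]
  simp only [inner_smul_left, inner_feature_featureSum hφ]
  rfl

lemma isHermitian_gram (hφ : ∀ z w, ⟪φ z, φ w⟫_ℝ = k z w) (x : ℕ → X) (n : ℕ) :
    (gram k x n).IsHermitian := by
  ext a b
  simp [gram, ← hφ, real_inner_comm]

lemma posSemidef_gram (hφ : ∀ z w, ⟪φ z, φ w⟫_ℝ = k z w) (x : ℕ → X) (n : ℕ) :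
    (gram k x n).PosSemidef := by
  refine .of_dotProduct_mulVec_nonneg (isHermitian_gram hφ x n) fun c => ?_
  rw [star_trivial, ← inner_featureSum_featureSum hφ]
  exact real_inner_self_nonneg

lemma posDef_gram_add (hφ : ∀ z w, ⟪φ z, φ w⟫_ℝ = k z w) (hlam : 0 < lam) (x : ℕ → X) (n : ℕ) :
    (gram k x n + lam • 1).PosDef :=
  .posSemidef_add (posSemidef_gram hφ x n) (Matrix.PosDef.one.smul hlam)

lemma gram_mulVec_ridge (hφ : ∀ z w, ⟪φ z, φ w⟫_ℝ = k z w) (hlam : 0 < lam) (x : ℕ → X) (n : ℕ)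
    (v : Fin n × Fin d → ℝ) :
    gram k x n *ᵥ ridge k lam x n v + lam • ridge k lam x n v = v := by
  have h : (gram k x n + lam • 1) *ᵥ ridge k lam x n v = v := by
    have hdet := (posDef_gram_add hφ hlam x n).det_pos.ne'
    rw [ridge, Matrix.mulVec_mulVec, Matrix.mul_nonsing_inv _ (isUnit_iff_ne_zero.2 hdet),
      Matrix.one_mulVec]
  rwa [Matrix.add_mulVec, Matrix.smul_mulVec, Matrix.one_mulVec] at h

/-- The posterior covariance is the covariance of the residuals plus a ridge term. -/
lemma postCov_eq_inner (hφ : ∀ z w, ⟪φ z, φ w⟫_ℝ = k z w) (hlam : 0 < lam) (x : ℕ → X) (n : ℕ)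
    (z w : X × Fin d) :
    postCov k lam x n z w =
      ⟪φ z - featureSum φ x n (ridge k lam x n (kvec k x n z)),
        φ w - featureSum φ x n (ridge k lam x n (kvec k x n w))⟫_ℝ +
        lam * (ridge k lam x n (kvec k x n z) ⬝ᵥ ridge k lam x n (kvec k x n w)) := by
  have h := gram_mulVec_ridge hφ hlam x n (kvec k x n w)
  have hc : postCov k lam x n z w =
    k z w - kvec k x n z ⬝ᵥ ridge k lam x n (kvec k x n w) := rfl
  set α := ridge k lam x n (kvec k x n z)
  set β := ridge k lam x n (kvec k x n w)
  have h1 := congrArg (fun v => α ⬝ᵥ v) h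
  simp only [dotProduct_add, dotProduct_smul, smul_eq_mul] at h1
  rw [hc, inner_sub_left, inner_sub_right, inner_sub_right,
    real_inner_comm (φ w) (featureSum φ x n α),
    inner_feature_featureSum hφ, inner_feature_featureSum hφ, inner_featureSum_featureSum hφ, hφ]
  rw [dotProduct_comm (kvec k x n w)]
  linarith

lemma postCov_eq (hφ : ∀ z w, ⟪φ z, φ w⟫_ℝ = k z w) (hlam : 0 < lam) (x : ℕ → X) (n : ℕ)
    (z : X × Fin d) :
    postCov k lam x n z z =
      ‖φ z - featureSum φ x n (ridge k lam x n (kvec k x n z))‖ ^ 2 +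
        lam * (ridge k lam x n (kvec k x n z) ⬝ᵥ ridge k lam x n (kvec k x n z)) := by
  rw [postCov_eq_inner hφ hlam, real_inner_self_eq_norm_sq]

/-- Ridge coefficients minimise this quadratic functional: at `c = α + D` the normal equations
cancel the terms linear in `D`, leaving a nonnegative remainder. -/
lemma postCov_le (hφ : ∀ z w, ⟪φ z, φ w⟫_ℝ = k z w) (hlam : 0 < lam) (x : ℕ → X) (n : ℕ)
    (z : X × Fin d) (c : Fin n × Fin d → ℝ) :
    postCov k lam x n z z ≤ ‖φ z - featureSum φ x n c‖ ^ 2 + lam * (c ⬝ᵥ c) := by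
  have h := gram_mulVec_ridge hφ hlam x n (kvec k x n z)
  rw [postCov_eq hφ hlam]
  set α := ridge k lam x n (kvec k x n z)
  obtain ⟨D, rfl⟩ : ∃ D, c = α + D := ⟨c - α, by simp⟩
  have h1 := congrArg (fun v => v ⬝ᵥ D) h
  simp only [add_dotProduct, smul_dotProduct, smul_eq_mul] at h1
  have h2 : ⟪φ z - featureSum φ x n α, featureSum φ x n D⟫_ℝ = lam * (α ⬝ᵥ D) := by
    rw [inner_sub_left, inner_feature_featureSum hφ, real_inner_comm,
      inner_featureSum_featureSum hφ, dotProduct_comm D]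
    linarith
  rw [featureSum_add, ← sub_sub, norm_sub_sq_real (φ z - featureSum φ x n α) (featureSum φ x n D), h2]
  simp only [add_dotProduct, dotProduct_add]
  rw [dotProduct_comm D α]
  have h3 : 0 ≤ D ⬝ᵥ D := by
    simpa using dotProduct_star_self_nonneg D
  nlinarith [sq_nonneg ‖featureSum φ x n D‖, mul_nonneg hlam.le h3]

lemma postCov_nonneg (hφ : ∀ z w, ⟪φ z, φ w⟫_ℝ = k z w) (hlam : 0 < lam) (x : ℕ → X) (n : ℕ)
    (z : X × Fin d) : 0 ≤ postCov k lam x n z z := by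
  rw [postCov_eq hφ hlam]
  have h3 : 0 ≤ ridge k lam x n (kvec k x n z) ⬝ᵥ ridge k lam x n (kvec k x n z) := by
    simpa using dotProduct_star_self_nonneg (ridge k lam x n (kvec k x n z))
  positivity

lemma postCov_le_kernel (hφ : ∀ z w, ⟪φ z, φ w⟫_ℝ = k z w) (hlam : 0 < lam) (x : ℕ → X) (n : ℕ)
    (z : X × Fin d) : postCov k lam x n z z ≤ k z z := by
  have h := postCov_le hφ hlam x n z 0
  have h0 : featureSum φ x n 0 = 0 := by simp [featureSum]
  rwa [h0, sub_zero, ← real_inner_self_eq_norm_sq, hφ, dotProduct_zero, mul_zero, add_zero] at h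

lemma postCov_succ_le (hφ : ∀ z w, ⟪φ z, φ w⟫_ℝ = k z w) (hlam : 0 < lam) (x : ℕ → X) (n : ℕ)
    (z : X × Fin d) : postCov k lam x (n + 1) z z ≤ postCov k lam x n z z := by
  rw [postCov_eq hφ hlam x n]
  set α := ridge k lam x n (kvec k x n z)
  -- The old optimal coefficients, with zero weight on the new query, are a competitor in the larger
  -- minimisation.
  let c : Fin (n + 1) × Fin d → ℝ :=
    fun a => Fin.lastCases (motive := fun _ => ℝ) 0 (fun t => α (t, a.2)) a.1
  have h := postCov_le hφ hlam x (n + 1) z c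
  have h1 : featureSum φ x (n + 1) c = featureSum φ x n α := by
    simp [featureSum, Fintype.sum_prod_type, Fin.sum_univ_castSucc, c]
  have h2 : c ⬝ᵥ c = α ⬝ᵥ α := by
    simp [dotProduct, Fintype.sum_prod_type, Fin.sum_univ_castSucc, c]
  rwa [h1, h2] at h

lemma postCov_antitone (hφ : ∀ z w, ⟪φ z, φ w⟫_ℝ = k z w) (hlam : 0 < lam) (x : ℕ → X)
    (z : X × Fin d) : Antitone fun n => postCov k lam x n z z :=
  antitone_nat_of_succ_le fun n => postCov_succ_le hφ hlam x n z

/-- The noiseless interpolant has norm at most that of the interpolated function. -/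
lemma norm_featureSum_ridge_le (hφ : ∀ z w, ⟪φ z, φ w⟫_ℝ = k z w) (hlam : 0 < lam) (x : ℕ → X)
    (n : ℕ) (g : E) :
    ‖featureSum φ x n
      (ridge k lam x n fun a : Fin n × Fin d => ⟪g, φ (x a.1, a.2)⟫_ℝ)‖ ≤ ‖g‖ := by
  have h := gram_mulVec_ridge hφ hlam x n fun a : Fin n × Fin d => ⟪g, φ (x a.1, a.2)⟫_ℝ
  set c := ridge k lam x n fun a : Fin n × Fin d => ⟪g, φ (x a.1, a.2)⟫_ℝ
  have h1 := congrArg (fun v => c ⬝ᵥ v) h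
  simp only [dotProduct_add, dotProduct_smul, smul_eq_mul] at h1
  rw [← inner_featureSum_featureSum hφ, dotProduct_comm c (fun a : Fin n × Fin d => ⟪g, φ (x a.1, a.2)⟫_ℝ),
    ← inner_featureSum_right, real_inner_self_eq_norm_sq] at h1
  have h3 : 0 ≤ c ⬝ᵥ c := by simpa using dotProduct_star_self_nonneg c
  have h4 := real_inner_le_norm g (featureSum φ x n c)
  -- With `c` the ridge coefficients, `h1` and `h4` give `‖Φc‖² ≤ ⟪g, Φc⟫ ≤ ‖g‖ ‖Φc‖`, where `Φ` is
  -- `featureSum`.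
  by_contra! hlt
  nlinarith [mul_nonneg hlam.le h3, norm_nonneg g]

/-- Since `v = Kc + λc`, the right side is `‖ΦKc + λΦc‖²`, whose cross term `2λ|Kc|²` is
nonnegative. -/
lemma norm_sq_featureSum_ridge_le (hφ : ∀ z w, ⟪φ z, φ w⟫_ℝ = k z w) (hlam : 0 < lam)
    (x : ℕ → X) (n : ℕ) (v : Fin n × Fin d → ℝ) :
    lam ^ 2 * ‖featureSum φ x n (ridge k lam x n v)‖ ^ 2 ≤ v ⬝ᵥ gram k x n *ᵥ v := by
  have h := gram_mulVec_ridge hφ hlam x n v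
  set c := ridge k lam x n v
  rw [← inner_featureSum_featureSum hφ, real_inner_self_eq_norm_sq, ← h, featureSum_add,
    @norm_add_sq_real]
  have h1 : featureSum φ x n (lam • c) = lam • featureSum φ x n c := by
    simp [featureSum, mul_smul, Finset.smul_sum]
  have h2 : ⟪featureSum φ x n (gram k x n *ᵥ c), featureSum φ x n c⟫_ℝ =
      (gram k x n *ᵥ c) ⬝ᵥ (gram k x n *ᵥ c) := inner_featureSum_featureSum hφ _ _ _ _
  have h3 : 0 ≤ (gram k x n *ᵥ c) ⬝ᵥ (gram k x n *ᵥ c) := by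
    simpa using dotProduct_star_self_nonneg (gram k x n *ᵥ c)
  rw [h1, inner_smul_right, h2, norm_smul, mul_pow, Real.norm_eq_abs, sq_abs]
  nlinarith [mul_nonneg hlam.le h3, sq_nonneg ‖featureSum φ x n (gram k x n *ᵥ c)‖]

/-- The bias of the posterior mean of noiseless data. -/
lemma abs_bias_le (hφ : ∀ z w, ⟪φ z, φ w⟫_ℝ = k z w) (hlam : 0 < lam) (x : ℕ → X) (n : ℕ)
    (g : E) (z : X × Fin d) :
    |ridge k lam x n (kvec k x n z) ⬝ᵥ (fun a : Fin n × Fin d => ⟪g, φ (x a.1, a.2)⟫_ℝ) -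
      ⟪g, φ z⟫_ℝ| ≤ ‖g‖ * √(postCov k lam x n z z) := by
  rw [dotProduct_comm, ← inner_featureSum_right, ← inner_sub_right]
  refine (abs_real_inner_le_norm _ _).trans
    (mul_le_mul_of_nonneg_left (Real.le_sqrt_of_sq_le ?_) (norm_nonneg g))
  rw [norm_sub_rev, postCov_eq hφ hlam]
  have h3 : 0 ≤ ridge k lam x n (kvec k x n z) ⬝ᵥ ridge k lam x n (kvec k x n z) := by
    simpa using dotProduct_star_self_nonneg (ridge k lam x n (kvec k x n z))
  nlinarith [mul_nonneg hlam.le h3]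

lemma mul_ridge_dotProduct_self_le (hφ : ∀ z w, ⟪φ z, φ w⟫_ℝ = k z w) (hlam : 0 < lam)
    (x : ℕ → X) (n : ℕ) (z : X × Fin d) :
    lam * (ridge k lam x n (kvec k x n z) ⬝ᵥ ridge k lam x n (kvec k x n z)) ≤
      postCov k lam x n z z := by
  rw [postCov_eq hφ hlam]
  exact le_add_of_nonneg_left (sq_nonneg _)

lemma kvec_dotProduct_ridge (hφ : ∀ z w, ⟪φ z, φ w⟫_ℝ = k z w) (x : ℕ → X) (n : ℕ)
    (z : X × Fin d) (v : Fin n × Fin d → ℝ) :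
    kvec k x n z ⬝ᵥ ridge k lam x n v = ridge k lam x n (kvec k x n z) ⬝ᵥ v := by
  have hs : ((gram k x n + lam • 1)⁻¹)ᵀ = (gram k x n + lam • 1)⁻¹ := by
    rw [Matrix.transpose_nonsing_inv, Matrix.transpose_add, Matrix.transpose_smul,
      Matrix.transpose_one]
    congr 2
    rw [← Matrix.conjTranspose_eq_transpose_of_trivial]
    exact isHermitian_gram hφ x n
  rw [ridge, ridge, Matrix.dotProduct_mulVec, ← Matrix.mulVec_transpose, hs]

end Features

/-! ### Determinants and posterior covariances -/

lemma one_add_sum_le_prod_one_add {ι : Type*} (s : Finset ι) {f : ι → ℝ} (hf : ∀ i ∈ s, 0 ≤ f i) :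
    1 + ∑ i ∈ s, f i ≤ ∏ i ∈ s, (1 + f i) := by
  classical
  induction s using Finset.induction_on with
  | empty => simp
  | insert a s ha ih =>
    rw [Finset.sum_insert ha, Finset.prod_insert ha]
    have h1 := ih fun i hi => hf i (Finset.mem_insert_of_mem hi)
    have h2 := hf a (Finset.mem_insert_self a s)
    have h3 : 0 ≤ ∑ i ∈ s, f i := Finset.sum_nonneg fun i hi => hf i (Finset.mem_insert_of_mem hi)
    nlinarith [mul_nonneg h2 h3]

lemma one_add_trace_le_det_one_add {ι : Type*} [Fintype ι] [DecidableEq ι] {A : Matrix ι ι ℝ}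
    (hA : A.PosSemidef) : 1 + A.trace ≤ (1 + A).det := by
  -- At `-1` the characteristic polynomial is `det (1 + A)` up to sign, hence the product of `1 +
  -- eigenvalue`.
  have h := congrArg (Polynomial.eval (-1)) hA.1.charpoly_eq
  rw [Matrix.eval_charpoly, Polynomial.eval_prod] at h
  have h1 : (Matrix.scalar ι) (-1 : ℝ) - A = -(1 + A) := by
    rw [map_neg, map_one, neg_add, sub_eq_add_neg]
  have h2 : ∀ i, Polynomial.eval (-1) (Polynomial.X - Polynomial.C ((hA.1.eigenvalues i : ℝ))) =
      -(1 + hA.1.eigenvalues i) := fun i => by simp; ring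
  simp only [RCLike.ofReal_real_eq_id, id_eq] at h
  rw [h1, Matrix.det_neg, Finset.prod_congr rfl fun i _ => h2 i, Finset.prod_neg,
    Finset.card_univ] at h
  have h3 := mul_left_cancel₀ (pow_ne_zero _ (by norm_num)) h
  rw [h3, hA.1.trace_eq_sum_eigenvalues]
  exact one_add_sum_le_prod_one_add _ fun i _ => hA.eigenvalues_nonneg i

section InfoGain

open scoped InnerProductSpace

variable {X : Type*} {d : ℕ} {E : Type*} [NormedAddCommGroup E] [InnerProductSpace ℝ E]
  {k : X × Fin d → X × Fin d → ℝ} {φ : X × Fin d → E} {lam : ℝ}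

lemma posSemidef_postCov (hφ : ∀ z w, ⟪φ z, φ w⟫_ℝ = k z w) (hlam : 0 < lam) (x : ℕ → X) (n : ℕ)
    (u : X) : (Matrix.of fun l l' => postCov k lam x n (u, l) (u, l')).PosSemidef := by
  let α : Matrix (Fin d) (Fin n × Fin d) ℝ := Matrix.of fun l => ridge k lam x n (kvec k x n (u, l))
  have h : (Matrix.of fun l l' => postCov k lam x n (u, l) (u, l')) =
      Matrix.gram ℝ (fun l => φ (u, l) - featureSum φ x n (ridge k lam x n (kvec k x n (u, l)))) +
        lam • (α * αᴴ) := by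
    ext l l'
    simp only [Matrix.of_apply, postCov_eq_inner hφ hlam, Matrix.add_apply, Matrix.gram_apply,
      Matrix.smul_apply, smul_eq_mul, Matrix.mul_apply, Matrix.conjTranspose_apply, star_trivial]
    rfl
  rw [h]
  exact (Matrix.posSemidef_gram ℝ _).add
    ((Matrix.posSemidef_self_mul_conjTranspose α).smul hlam.le)

/-- A query appends a block of `d` rows and columns; its Schur complement is the posterior
covariance of the new outputs plus `λI`. -/
lemma det_gram_succ (hφ : ∀ z w, ⟪φ z, φ w⟫_ℝ = k z w) (hlam : 0 < lam) (x : ℕ → X) (n : ℕ) :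
    (gram k x (n + 1) + lam • 1).det = (gram k x n + lam • 1).det *
      ((Matrix.of fun l l' => postCov k lam x n (x n, l) (x n, l')) + lam • 1).det := by
  let e : (Fin n × Fin d) ⊕ Fin d ≃ Fin (n + 1) × Fin d :=
    ((Equiv.refl _).sumCongr (Equiv.uniqueProd (Fin d) (Fin 1)).symm).trans
      ((Equiv.sumProdDistrib (Fin n) (Fin 1) (Fin d)).symm.trans
        (finSumFinEquiv.prodCongr (Equiv.refl _)))
  have he1 : ∀ a, e (Sum.inl a) = (a.1.castSucc, a.2) := fun a => rfl
  have he2 : ∀ l, e (Sum.inr l) = (Fin.last n, l) := fun l => rfl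
  have hdet := (posDef_gram_add hφ hlam x n).det_pos.ne'
  let : Invertible (gram k x n + lam • 1) :=
    Matrix.invertibleOfIsUnitDet _ (isUnit_iff_ne_zero.2 hdet)
  let C : Matrix (Fin d) (Fin n × Fin d) ℝ := Matrix.of fun l => kvec k x n (x n, l)
  have hb : (gram k x (n + 1) + lam • 1).submatrix e e =
      Matrix.fromBlocks (gram k x n + lam • 1) Cᵀ C
        ((Matrix.of fun l l' => k (x n, l) (x n, l')) + lam • 1) := by
    ext i j
    rcases i with i | i <;> rcases j with j | j
    · simp [he1, gram, Matrix.one_apply, Prod.ext_iff]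
    · have : (i.1.castSucc, i.2) ≠ (Fin.last n, j) := by
        simp [Prod.ext_iff, Fin.castSucc_ne_last]
      simp [he1, he2, gram, Matrix.one_apply_ne this, C, kvec, ← hφ, real_inner_comm]
    · have : (Fin.last n, i) ≠ (j.1.castSucc, j.2) := by
        simp [Prod.ext_iff, (Fin.castSucc_ne_last j.1).symm]
      simp [he1, he2, gram, Matrix.one_apply_ne this, C, kvec]
    · simp [he2, gram, Matrix.one_apply, Prod.ext_iff]
  rw [← Matrix.det_submatrix_equiv_self e, hb, Matrix.det_fromBlocks₁₁]
  congr 2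
  ext l l'
  simp only [Matrix.sub_apply, Matrix.add_apply, Matrix.of_apply, Matrix.smul_apply, postCov]
  rw [add_sub_right_comm]
  congr 2
  rw [Matrix.invOf_eq_nonsing_inv, Matrix.mul_assoc, Matrix.mul_apply]
  rfl

lemma det_one_add_smul {ι : Type*} [Fintype ι] [DecidableEq ι] (hlam : 0 < lam)
    (A : Matrix ι ι ℝ) :
    (1 + lam⁻¹ • A).det = lam⁻¹ ^ Fintype.card ι * (A + lam • 1).det := by
  rw [← Matrix.det_smul, smul_add, smul_smul, inv_mul_cancel₀ hlam.ne', one_smul, add_comm]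

lemma one_le_det_one_add_smul {ι : Type*} [Fintype ι] [DecidableEq ι] (hlam : 0 < lam)
    {A : Matrix ι ι ℝ} (hA : A.PosSemidef) : 1 ≤ (1 + lam⁻¹ • A).det :=
  le_trans (by simpa using (hA.smul (inv_pos.2 hlam).le).trace_nonneg)
    (one_add_trace_le_det_one_add (hA.smul (inv_pos.2 hlam).le))

/-- The variances that are met along the queries are controlled by the information gain. -/
lemma sum_log_le_log_det (hφ : ∀ z w, ⟪φ z, φ w⟫_ℝ = k z w) (hlam : 0 < lam) (x : ℕ → X) (n : ℕ) :
    ∑ t ∈ Finset.range n, Real.log (1 + (∑ l, postCov k lam x t (x t, l) (x t, l)) / lam) ≤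
      Real.log (1 + lam⁻¹ • gram k x n).det := by
  induction n with
  | zero => simp
  | succ n ih =>
    have hS := posSemidef_postCov hφ hlam x n (x n)
    set S : Matrix (Fin d) (Fin d) ℝ := Matrix.of fun l l' => postCov k lam x n (x n, l) (x n, l')
    have h : (1 + lam⁻¹ • gram k x (n + 1)).det =
        (1 + lam⁻¹ • gram k x n).det * (1 + lam⁻¹ • S).det := by
      rw [det_one_add_smul hlam, det_one_add_smul hlam, det_one_add_smul hlam,
        det_gram_succ hφ hlam]
      simp only [Fintype.card_prod, Fintype.card_fin, add_mul, one_mul, pow_add]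
      ring
    have h1 := one_le_det_one_add_smul hlam (posSemidef_gram hφ x n)
    have h2 := one_le_det_one_add_smul hlam hS
    rw [Finset.sum_range_succ, h, Real.log_mul (by positivity) (by positivity)]
    refine add_le_add ih (Real.log_le_log ?_ ?_)
    · have : 0 ≤ ∑ l, postCov k lam x n (x n, l) (x n, l) :=
        Finset.sum_nonneg fun l _ => postCov_nonneg hφ hlam x n _
      positivity
    · refine le_trans (le_of_eq ?_) (one_add_trace_le_det_one_add (hS.smul (inv_pos.2 hlam).le))
      rw [Matrix.trace_smul, smul_eq_mul, div_eq_inv_mul]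
      rfl

end InfoGain

/-! ### Lower bounds for the maximum information gain -/

section MaxInfoGain

open scoped InnerProductSpace

variable {Z E : Type*} [NormedAddCommGroup E] [InnerProductSpace ℝ E]
  {k : Z → Z → ℝ} {φ : Z → E} {lam : ℝ}

lemma posSemidef_of_feature {ι : Type*} [Finite ι] (hφ : ∀ z w, ⟪φ z, φ w⟫_ℝ = k z w)
    (z : ι → Z) : (Matrix.of fun i j => k (z i) (z j)).PosSemidef := by
  have h : (Matrix.of fun i j => k (z i) (z j)) = Matrix.gram ℝ (φ ∘ z) := by
    ext i j
    simp [Matrix.gram_apply, hφ]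
  rw [h]
  exact Matrix.posSemidef_gram ℝ _

lemma log_det_le_maxInfoGain [TopologicalSpace Z] [CompactSpace Z]
    (hk : Continuous fun q : Z × Z => k q.1 q.2) (hφ : ∀ z w, ⟪φ z, φ w⟫_ℝ = k z w)
    (hlam : 0 < lam) {m : ℕ} (z : Fin m → Z) :
    (1 / 2 : ℝ) * Real.log
      (1 + lam⁻¹ • (Matrix.of fun i j => k (z i) (z j) : Matrix (Fin m) (Fin m) ℝ)).det ≤
      maxInfoGain k lam m := by
  refine le_ciSup (f := fun z : Fin m → Z => (1 / 2 : ℝ) * Real.log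
      (1 + lam⁻¹ • (Matrix.of fun i j => k (z i) (z j) : Matrix (Fin m) (Fin m) ℝ)).det) ?_ z
  -- The supremum is only meaningful if bounded; compactness and continuity of the kernel supply
  -- this.
  refine (isCompact_range (Continuous.mul continuous_const (Continuous.log ?_ ?_))).bddAbove
  · refine Continuous.matrix_det (continuous_matrix fun i j => ?_)
    have h0 : Continuous fun z : Fin m → Z => (z i, z j) :=
      (continuous_apply i).prodMk (continuous_apply j)
    have h : Continuous fun z : Fin m → Z => k (z i) (z j) := hk.comp h0
    exact continuous_const.add (continuous_const.mul h)
  · intro z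
    have := one_le_det_one_add_smul hlam (posSemidef_of_feature hφ z)
    positivity

/-- Take all `m` points equal to `z` and bound the determinant below by one plus the trace. This
lower bound on the gain serves both the first query and the absorption of the discretization error.
-/
lemma log_one_add_le_maxInfoGain [TopologicalSpace Z] [CompactSpace Z]
    (hk : Continuous fun q : Z × Z => k q.1 q.2) (hφ : ∀ z w, ⟪φ z, φ w⟫_ℝ = k z w)
    (hlam : 0 < lam) (m : ℕ) (z : Z) :
    (1 / 2 : ℝ) * Real.log (1 + m * k z z / lam) ≤ maxInfoGain k lam m := by
  refine le_trans ?_ (log_det_le_maxInfoGain hk hφ hlam fun _ : Fin m => z)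
  have hA := posSemidef_of_feature hφ fun _ : Fin m => z
  have hz : 0 ≤ k z z := by rw [← hφ]; exact real_inner_self_nonneg
  refine mul_le_mul_of_nonneg_left (Real.log_le_log (by positivity) ?_) (by norm_num)
  refine le_trans (le_of_eq ?_) (one_add_trace_le_det_one_add (hA.smul (inv_pos.2 hlam).le))
  simp [Matrix.trace]
  ring

end MaxInfoGain

/-! ### Variance decay along a run -/

section MVRRun

open scoped InnerProductSpace

variable {X : Type*} {d : ℕ} {E : Type*} [NormedAddCommGroup E] [InnerProductSpace ℝ E]
  {k : X × Fin d → X × Fin d → ℝ} {φ : X × Fin d → E} {lam : ℝ}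

lemma log_det_gram_le_maxInfoGain [TopologicalSpace X] [CompactSpace X]
    (hk : Continuous fun q : (X × Fin d) × (X × Fin d) => k q.1 q.2)
    (hφ : ∀ z w, ⟪φ z, φ w⟫_ℝ = k z w) (hlam : 0 < lam) (x : ℕ → X) (n : ℕ) :
    Real.log (1 + lam⁻¹ • gram k x n).det ≤ 2 * maxInfoGain k lam (n * d) := by
  let z : Fin (n * d) → X × Fin d := fun i =>
    (x (finProdFinEquiv.symm i).1, (finProdFinEquiv.symm i).2)
  have h := log_det_le_maxInfoGain hk hφ hlam z
  have h1 : (1 + lam⁻¹ • (Matrix.of fun i j => k (z i) (z j))) =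
      (1 + lam⁻¹ • gram k x n).submatrix finProdFinEquiv.symm finProdFinEquiv.symm := by
    rw [Matrix.submatrix_add, Pi.add_apply, Pi.add_apply, Matrix.submatrix_one_equiv]
    rfl
  rw [h1, Matrix.det_submatrix_equiv_self] at h
  linarith

/-- By concavity of the logarithm. -/
lemma mul_log_one_add_inv_le (hlam : 0 < lam) {s D : ℝ} (hs : 0 ≤ s) (hsD : s ≤ D) (hD : 1 ≤ D) :
    s * Real.log (1 + 1 / lam) ≤ D * Real.log (1 + s / lam) := by
  have h1 : Real.log (1 + 1 / lam) ≤ Real.log (1 + D / lam) :=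
    Real.log_le_log (by positivity) (by gcongr)
  have hD0 : 0 < D := by linarith
  have hc := strictConcaveOn_log_Ioi.concaveOn.2 (show (1 : ℝ) ∈ Set.Ioi 0 from Set.mem_Ioi.2 one_pos)
    (show 1 + D / lam ∈ Set.Ioi 0 from by rw [Set.mem_Ioi]; positivity)
    (show 0 ≤ 1 - s / D from by rw [sub_nonneg, div_le_one hD0]; exact hsD)
    (show 0 ≤ s / D by positivity) (by ring)
  simp only [smul_eq_mul, Real.log_one, mul_zero, zero_add] at hc
  have h2 : (1 - s / D) * 1 + s / D * (1 + D / lam) = 1 + s / lam := by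
    field_simp
    ring
  rw [h2] at hc
  calc s * Real.log (1 + 1 / lam) ≤ s * Real.log (1 + D / lam) := by gcongr
    _ = D * (s / D * Real.log (1 + D / lam)) := by field_simp
    _ ≤ _ := by gcongr

lemma norm_sq_postSd (hφ : ∀ z w, ⟪φ z, φ w⟫_ℝ = k z w) (hlam : 0 < lam) (x : ℕ → X) (n : ℕ)
    (u : X) : ‖postSd k lam x n u‖ ^ 2 = ∑ l, postCov k lam x n (u, l) (u, l) := by
  rw [EuclideanSpace.norm_sq_eq]
  refine Finset.sum_congr rfl fun l _ => ?_
  simp only [postSd, Real.norm_eq_abs, sq_abs]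
  exact Real.sq_sqrt (postCov_nonneg hφ hlam x n _)

/-- Maximum variance reduction makes the posterior variance small everywhere. -/
lemma IsMVRRun.sum_postCov_le [TopologicalSpace X] [CompactSpace X]
    (hk : Continuous fun q : (X × Fin d) × (X × Fin d) => k q.1 q.2) (hk1 : ∀ z w, k z w ≤ 1)
    (hφ : ∀ z w, ⟪φ z, φ w⟫_ℝ = k z w) (hlam : 0 < lam) {x : ℕ → X} {n : ℕ} (hn : 1 ≤ n)
    (hd : 1 ≤ d) (hx : IsMVRRun k lam n x) (u : X) :
    n * (∑ l, postCov k lam x n (u, l) (u, l)) * Real.log (1 + 1 / lam) ≤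
      4 * d * maxInfoGain k lam (n * d) := by
  set Γ := maxInfoGain k lam (n * d)
  have hd1 : (1 : ℝ) ≤ d := by exact_mod_cast hd
  have hl : 0 < Real.log (1 + 1 / lam) := Real.log_pos (by simp [hlam])
  have hV0 : ∀ t v, 0 ≤ ∑ l, postCov k lam x t (v, l) (v, l) := fun t v =>
    Finset.sum_nonneg fun l _ => postCov_nonneg hφ hlam x t _
  have hVd : ∀ t v, ∑ l, postCov k lam x t (v, l) (v, l) ≤ d := fun t v => by
    refine (Finset.sum_le_sum fun l _ =>
      (postCov_le_kernel hφ hlam x t (v, l)).trans (hk1 _ _)).trans (by simp)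
  -- `t = 0` is excluded: the algorithm starts from the constant deviation 1, so its first query
  -- maximises nothing.
  have hstep : ∀ t, 1 ≤ t → t < n → ∑ l, postCov k lam x n (u, l) (u, l) ≤
      ∑ l, postCov k lam x t (x t, l) (x t, l) := fun t ht htn => by
    refine (Finset.sum_le_sum fun l _ => postCov_antitone hφ hlam x (u, l) htn.le).trans ?_
    obtain ⟨t, rfl⟩ : ∃ s, t = s + 1 := ⟨t - 1, by omega⟩
    have := hx (t + 1) htn u
    simp only [algSd] at this
    rw [← norm_sq_postSd hφ hlam, ← norm_sq_postSd hφ hlam]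
    gcongr
  -- Stands in for the missing summand `t = 0`: each output's variance is at most `k(z,z)`, which
  -- the gain of a repeated point controls.
  have hfirst : (∑ l, postCov k lam x n (u, l) (u, l)) * Real.log (1 + 1 / lam) ≤
      d * (2 * Γ) := by
    rw [Finset.sum_mul]
    refine (Finset.sum_le_sum (g := fun _ => 2 * Γ) fun l _ => ?_).trans (by simp)
    have h1 := log_one_add_le_maxInfoGain hk hφ hlam (n * d) (u, l)
    have h0 := postCov_nonneg hφ hlam x n (u, l)
    have h2 := postCov_le_kernel hφ hlam x n (u, l)
    have h3 := mul_log_one_add_inv_le hlam h0 (h2.trans (hk1 _ _)) le_rfl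
    have h4 : Real.log (1 + postCov k lam x n (u, l) (u, l) / lam) ≤
        Real.log (1 + (n * d : ℕ) * k (u, l) (u, l) / lam) := by
      refine Real.log_le_log (by positivity) ?_
      have : (1 : ℝ) ≤ (n * d : ℕ) := by exact_mod_cast Nat.mul_pos hn hd
      have hk0 := h0.trans h2
      gcongr
      nlinarith
    linarith
  have hrest : ∀ t ∈ Finset.range n, 1 ≤ t →
      (∑ l, postCov k lam x n (u, l) (u, l)) * Real.log (1 + 1 / lam) ≤
        d * Real.log (1 + (∑ l, postCov k lam x t (x t, l) (x t, l)) / lam) := fun t ht ht1 =>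
    (mul_le_mul_of_nonneg_right (hstep t ht1 (Finset.mem_range.1 ht)) hl.le).trans
      (mul_log_one_add_inv_le hlam (hV0 t _) (hVd t _) hd1)
  have hsum := (sum_log_le_log_det hφ hlam x n).trans (log_det_gram_le_maxInfoGain hk hφ hlam x n)
  obtain ⟨m, rfl⟩ : ∃ m, n = m + 1 := ⟨n - 1, by omega⟩
  rw [Finset.sum_range_succ'] at hsum
  have hz : 0 ≤ Real.log (1 + (∑ l, postCov k lam x 0 (x 0, l) (x 0, l)) / lam) :=
    Real.log_nonneg (le_add_of_nonneg_right (div_nonneg (hV0 0 _) hlam.le))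
  have hm : (m : ℝ) * ((∑ l, postCov k lam x (m + 1) (u, l) (u, l)) * Real.log (1 + 1 / lam)) ≤
      d * (2 * Γ) := by
    have h5 := Finset.sum_le_sum fun t (ht : t ∈ Finset.range m) =>
      hrest (t + 1) (by simpa using ht) (by omega)
    rw [Finset.sum_const, Finset.card_range, nsmul_eq_mul, ← Finset.mul_sum] at h5
    refine h5.trans (mul_le_mul_of_nonneg_left ?_ (by positivity))
    linarith
  push_cast
  linarith

end MVRRun

/-! ### Gaussian tails and union bounds -/

section Noise

variable {d : ℕ} {Ω : Type*} [MeasurableSpace Ω] {P : Measure Ω}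
  {ω : ℕ → Ω → EuclideanSpace ℝ (Fin d)} {σ : ℝ}

open scoped InnerProductSpace NNReal

lemma hasSubgaussianMGF_inner {Y : Ω → EuclideanSpace ℝ (Fin d)}
    (hY : HasLaw Y (multivariateGaussian 0 (σ ^ 2 • (1 : Matrix (Fin d) (Fin d) ℝ))) P)
    (c : EuclideanSpace ℝ (Fin d)) :
    HasSubgaussianMGF (fun w => ⟪c, Y w⟫_ℝ) (Real.toNNReal (σ ^ 2 * ‖c‖ ^ 2)) P := by
  set S : Matrix (Fin d) (Fin d) ℝ := σ ^ 2 • 1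
  have hS : S.PosSemidef := Matrix.PosSemidef.one.smul (sq_nonneg σ)
  have h1 : (multivariateGaussian 0 S).map (fun v => ⟪c, v⟫_ℝ) =
      gaussianReal 0 (Real.toNNReal (σ ^ 2 * ‖c‖ ^ 2)) := by
    have h := IsGaussian.map_eq_gaussianReal (μ := multivariateGaussian 0 S) (innerSL ℝ c)
    have h2 : Var[(innerSL ℝ c); multivariateGaussian 0 S] = σ ^ 2 * ‖c‖ ^ 2 := by
      have := covarianceBilin_self (μ := multivariateGaussian 0 S) IsGaussian.memLp_two_id c
      rw [covarianceBilin_multivariateGaussian hS] at this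
      refine Eq.trans this.symm ?_
      rw [Matrix.smul_mulVec, Matrix.one_mulVec, dotProduct_smul, smul_eq_mul,
        EuclideanSpace.norm_sq_eq]
      simp [dotProduct, sq]
    have h3 : ∫ v, (innerSL ℝ c) v ∂(multivariateGaussian 0 S) = 0 := by
      rw [ContinuousLinearMap.integral_comp_id_comm IsGaussian.integrable_id]
      simp
    rw [h2, h3] at h
    exact h
  have h4 : P.map (fun w => ⟪c, Y w⟫_ℝ) = gaussianReal 0 (Real.toNNReal (σ ^ 2 * ‖c‖ ^ 2)) := by
    rw [← h1, ← hY.map_eq, AEMeasurable.map_map_of_aemeasurable (by fun_prop) hY.aemeasurable]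
    rfl
  have hm : AEMeasurable (fun w => ⟪c, Y w⟫_ℝ) P := by
    have := hY.aemeasurable
    fun_prop
  constructor
  · intro t
    have := integrable_exp_mul_gaussianReal (μ := 0) (v := Real.toNNReal (σ ^ 2 * ‖c‖ ^ 2)) t
    rw [← h4] at this
    exact (integrable_map_measure (by fun_prop) hm).1 this
  · intro t
    rw [mgf_gaussianReal h4]
    simp

/-- The noise of the first `n` queries, as a vector indexed by queries and output coordinates. -/
noncomputable def noise (ω : ℕ → Ω → EuclideanSpace ℝ (Fin d)) {n : ℕ} (w : Ω) :
    Fin n × Fin d → ℝ :=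
  fun a => ω a.1 w a.2

lemma hasSubgaussianMGF_noise [IsProbabilityMeasure P] (hindep : iIndepFun ω P)
    (hω : ∀ t, HasLaw (ω t) (multivariateGaussian 0 (σ ^ 2 • (1 : Matrix (Fin d) (Fin d) ℝ))) P)
    {n : ℕ} (c : Fin n × Fin d → ℝ) :
    HasSubgaussianMGF (fun w => c ⬝ᵥ noise ω w) (Real.toNNReal (σ ^ 2 * (c ⬝ᵥ c))) P := by
  let C : Fin n → EuclideanSpace ℝ (Fin d) := fun t => WithLp.toLp 2 fun l => c (t, l)
  have h1 : iIndepFun (fun (t : Fin n) w => ⟪C t, ω t w⟫_ℝ) P :=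
    (hindep.precomp Fin.val_injective).comp (fun t v => ⟪C t, v⟫_ℝ) fun t => by fun_prop
  have h2 := HasSubgaussianMGF.sum_of_iIndepFun h1 (s := Finset.univ)
    fun t _ => hasSubgaussianMGF_inner (hω t) (C t)
  convert h2 using 1
  · ext w
    simp [dotProduct, Fintype.sum_prod_type, noise, C, PiLp.inner_apply, mul_comm]
  · rw [← Real.toNNReal_sum_of_nonneg fun t _ => by positivity, ← Finset.mul_sum]
    simp only [EuclideanSpace.norm_sq_eq]
    simp [dotProduct, Fintype.sum_prod_type, C, ← sq]

lemma measure_noise_gt_le [IsProbabilityMeasure P] (hindep : iIndepFun ω P)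
    (hω : ∀ t, HasLaw (ω t) (multivariateGaussian 0 (σ ^ 2 • (1 : Matrix (Fin d) (Fin d) ℝ))) P)
    (hσ : 0 < σ) {n : ℕ} (c : Fin n × Fin d → ℝ) {η : ℝ} (hη : 0 < η) (hη1 : η ≤ 1) :
    P {w | σ * √(c ⬝ᵥ c) * √(2 * Real.log (2 / η)) < |c ⬝ᵥ noise ω w|} ≤ ENNReal.ofReal η := by
  have hc0 : 0 ≤ c ⬝ᵥ c := by simpa using dotProduct_star_self_nonneg c
  -- For `c = 0` the variance proxy vanishes and the exponent below would be a division by zero.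
  rcases hc0.eq_or_lt with hc | hc
  · have : c = 0 := by
      rw [eq_comm] at hc
      simpa using hc
    simp [this]
  have hL : 0 ≤ Real.log (2 / η) := Real.log_nonneg (by rw [le_div_iff₀ hη]; linarith)
  have hε : 0 ≤ σ * √(c ⬝ᵥ c) * √(2 * Real.log (2 / η)) := by positivity
  -- The threshold is chosen so that each one-sided tail bound is exactly `η / 2`.
  have hexp : Real.exp (-(σ * √(c ⬝ᵥ c) * √(2 * Real.log (2 / η))) ^ 2 /
      (2 * (Real.toNNReal (σ ^ 2 * (c ⬝ᵥ c)) : ℝ))) = η / 2 := by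
    rw [Real.coe_toNNReal _ (by positivity), mul_pow, mul_pow, Real.sq_sqrt hc0,
      Real.sq_sqrt (by positivity)]
    have : -(σ ^ 2 * (c ⬝ᵥ c) * (2 * Real.log (2 / η))) / (2 * (σ ^ 2 * (c ⬝ᵥ c))) =
        Real.log (η / 2) := by
      rw [← inv_div 2 η, Real.log_inv]
      field_simp
    rw [this, Real.exp_log (by positivity)]
  have hsub := hasSubgaussianMGF_noise hindep hω c
  have h1 := hsub.measure_ge_le hε
  have h2 := hsub.neg.measure_ge_le hε
  rw [hexp] at h1 h2
  refine (measure_mono (t := {w | σ * √(c ⬝ᵥ c) * √(2 * Real.log (2 / η)) ≤ c ⬝ᵥ noise ω w} ∪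
    {w | σ * √(c ⬝ᵥ c) * √(2 * Real.log (2 / η)) ≤ (-fun w => c ⬝ᵥ noise ω w) w})
    fun w hw => ?_).trans ?_
  · rw [Set.mem_ofPred_eq, lt_abs] at hw
    exact hw.imp le_of_lt le_of_lt
  · refine (measure_union_le _ _).trans ?_
    rw [← ofReal_measureReal, ← ofReal_measureReal, ← ENNReal.ofReal_add (by positivity) (by positivity)]
    exact ENNReal.ofReal_le_ofReal (by linarith)

/-- A union bound for finitely many linear statistics of the noise. -/
lemma measure_exists_noise_gt_le [IsProbabilityMeasure P] (hindep : iIndepFun ω P)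
    (hω : ∀ t, HasLaw (ω t) (multivariateGaussian 0 (σ ^ 2 • (1 : Matrix (Fin d) (Fin d) ℝ))) P)
    (hσ : 0 < σ) {n : ℕ} {ι : Type*} (s : Finset ι) (c : ι → Fin n × Fin d → ℝ) {η : ℝ}
    (hη : 0 < η) (hη1 : η ≤ 1) {m : ℝ} (hm : 1 ≤ m) (hs : (s.card : ℝ) ≤ m) :
    P {w | ∃ i ∈ s, σ * √(c i ⬝ᵥ c i) * √(2 * Real.log (2 / (η / m))) < |c i ⬝ᵥ noise ω w|} ≤
      ENNReal.ofReal η := by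
  have hm0 : 0 < m := by linarith
  have h : {w | ∃ i ∈ s, σ * √(c i ⬝ᵥ c i) * √(2 * Real.log (2 / (η / m))) <
      |c i ⬝ᵥ noise ω w|} = ⋃ i ∈ s,
      {w | σ * √(c i ⬝ᵥ c i) * √(2 * Real.log (2 / (η / m))) < |c i ⬝ᵥ noise ω w|} := by
    ext w
    simp
  rw [h]
  refine (measure_biUnion_finset_le _ _).trans ((Finset.sum_le_sum fun i _ =>
    measure_noise_gt_le hindep hω hσ (c i) (η := η / m) (by positivity)
      ((div_le_self hη.le hm).trans hη1)).trans ?_)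
  rw [Finset.sum_const, nsmul_eq_mul, ← ENNReal.ofReal_natCast,
    ← ENNReal.ofReal_mul (by positivity)]
  refine ENNReal.ofReal_le_ofReal ?_
  rw [mul_div_assoc', div_le_iff₀ hm0, mul_comm]
  gcongr

-- The rows of the factor of the Gram matrix are the directions in which the noise must be
-- controlled to bound the norm of the error.
open scoped MatrixOrder in
lemma exists_factor_of_posSemidef {ι : Type*} [Fintype ι] [DecidableEq ι] {G : Matrix ι ι ℝ}
    (hG : G.PosSemidef) : ∃ A : Matrix ι ι ℝ, G = Aᴴ * A := by
  exact CStarAlgebra.nonneg_iff_eq_star_mul_self.mp hG.nonneg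

end Noise

/-! ### The error as an element of the Hilbert space -/

section Error

open scoped InnerProductSpace

variable {X : Type*} {d : ℕ} {E : Type*} [NormedAddCommGroup E] [InnerProductSpace ℝ E]
  {k : X × Fin d → X × Fin d → ℝ} {φ : X × Fin d → E} {lam : ℝ}

lemma ridge_add (x : ℕ → X) (n : ℕ) (v v' : Fin n × Fin d → ℝ) :
    ridge k lam x n (v + v') = ridge k lam x n v + ridge k lam x n v' :=
  Matrix.mulVec_add _ _ _

/-- Bias plus noise. -/
lemma abs_error_le (hφ : ∀ z w, ⟪φ z, φ w⟫_ℝ = k z w) (hlam : 0 < lam) (x : ℕ → X) (n : ℕ)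
    (g : E) (v : Fin n × Fin d → ℝ) (z : X × Fin d) :
    |kvec k x n z ⬝ᵥ ridge k lam x n ((fun a : Fin n × Fin d => ⟪g, φ (x a.1, a.2)⟫_ℝ) + v) -
      ⟪g, φ z⟫_ℝ| ≤
      ‖g‖ * √(postCov k lam x n z z) + |ridge k lam x n (kvec k x n z) ⬝ᵥ v| := by
  rw [kvec_dotProduct_ridge hφ, dotProduct_add, add_sub_right_comm]
  exact (abs_add_le _ _).trans (add_le_add_left (abs_bias_le hφ hlam x n g z) _)

/-- The error of the posterior mean, as an element of the Hilbert space. -/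
noncomputable def errorVec (k : X × Fin d → X × Fin d → ℝ) (φ : X × Fin d → E) (lam : ℝ)
    (x : ℕ → X) (n : ℕ) (g : E) (v : Fin n × Fin d → ℝ) : E :=
  featureSum φ x n
    (ridge k lam x n ((fun a : Fin n × Fin d => ⟪g, φ (x a.1, a.2)⟫_ℝ) + v)) - g

lemma inner_errorVec (hφ : ∀ z w, ⟪φ z, φ w⟫_ℝ = k z w) (x : ℕ → X) (n : ℕ)
    (g : E) (v : Fin n × Fin d → ℝ) (z : X × Fin d) :
    ⟪errorVec k φ lam x n g v, φ z⟫_ℝ =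
      kvec k x n z ⬝ᵥ ridge k lam x n ((fun a : Fin n × Fin d => ⟪g, φ (x a.1, a.2)⟫_ℝ) + v) -
        ⟪g, φ z⟫_ℝ := by
  rw [errorVec, inner_sub_left, real_inner_comm, inner_feature_featureSum hφ]

lemma norm_errorVec_le (hφ : ∀ z w, ⟪φ z, φ w⟫_ℝ = k z w) (hlam : 0 < lam) (x : ℕ → X) (n : ℕ)
    (g : E) (v : Fin n × Fin d → ℝ) :
    ‖errorVec k φ lam x n g v‖ ≤ 2 * ‖g‖ + ‖featureSum φ x n (ridge k lam x n v)‖ := by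
  rw [errorVec, ridge_add, featureSum_add]
  have h1 := norm_featureSum_ridge_le hφ hlam x n g
  have h2 := norm_sub_le (featureSum φ x n
    (ridge k lam x n fun a : Fin n × Fin d => ⟪g, φ (x a.1, a.2)⟫_ℝ) +
      featureSum φ x n (ridge k lam x n v)) g
  have h3 := norm_add_le (featureSum φ x n
    (ridge k lam x n fun a : Fin n × Fin d => ⟪g, φ (x a.1, a.2)⟫_ℝ))
      (featureSum φ x n (ridge k lam x n v))
  linarith

/-- The quadratic form is `|Av|²` and the trace is the sum of the squared row norms of `A`, so a
bound for each row adds up. -/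
lemma dotProduct_gram_mulVec_le {n : ℕ} {x : ℕ → X} {A : Matrix (Fin n × Fin d) (Fin n × Fin d) ℝ}
    (hA : gram k x n = Aᴴ * A) {v : Fin n × Fin d → ℝ} {s : ℝ}
    (hv : ∀ j, |A j ⬝ᵥ v| ≤ √(A j ⬝ᵥ A j) * s) :
    v ⬝ᵥ gram k x n *ᵥ v ≤ s ^ 2 * (gram k x n).trace := by
  have h1 : v ⬝ᵥ gram k x n *ᵥ v = ∑ j, (A j ⬝ᵥ v) ^ 2 := by
    rw [hA, ← Matrix.mulVec_mulVec, Matrix.dotProduct_mulVec,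
      Matrix.conjTranspose_eq_transpose_of_trivial, Matrix.vecMul_transpose]
    simp [dotProduct, Matrix.mulVec, sq]
  have h2 : (gram k x n).trace = ∑ j, A j ⬝ᵥ A j := by
    rw [hA, Matrix.trace_mul_comm]
    simp [Matrix.trace, Matrix.mul_apply, dotProduct]
  rw [h1, h2, Finset.mul_sum]
  refine Finset.sum_le_sum fun j _ => ?_
  have h3 : 0 ≤ A j ⬝ᵥ A j := by simpa using dotProduct_star_self_nonneg (A j)
  have h4 := pow_le_pow_left₀ (abs_nonneg _) (hv j) 2
  rw [sq_abs, mul_pow, Real.sq_sqrt h3] at h4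
  linarith

lemma norm_featureSum_ridge_noise_le (hφ : ∀ z w, ⟪φ z, φ w⟫_ℝ = k z w) (hlam : 0 < lam)
    {x : ℕ → X} {n : ℕ} {κ : ℝ} (hκ : ∀ z, k z z ≤ κ)
    {A : Matrix (Fin n × Fin d) (Fin n × Fin d) ℝ}
    (hA : gram k x n = Aᴴ * A) {v : Fin n × Fin d → ℝ} {σ L : ℝ} (hσ : 0 < σ)
    (hv : ∀ j, |A j ⬝ᵥ v| ≤ σ * √(A j ⬝ᵥ A j) * √L) :
    ‖featureSum φ x n (ridge k lam x n v)‖ ≤ σ / lam * √(n * d * κ) * √L := by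
  have h1 := dotProduct_gram_mulVec_le hA (s := σ * √L) fun j => (hv j).trans_eq (by ring)
  have h2 := norm_sq_featureSum_ridge_le hφ hlam x n v
  have h3 : (gram k x n).trace ≤ n * d * κ := by
    refine (Finset.sum_le_sum fun a _ => hκ _).trans (by simp)
  have h4 : 0 ≤ (gram k x n).trace := (posSemidef_gram hφ x n).trace_nonneg
  refine le_of_mul_le_mul_left ?_ hlam
  refine abs_le_of_sq_le_sq' ?_ (by positivity) |>.2
  have h5 : (lam * (σ / lam * √(n * d * κ) * √L)) ^ 2 = (σ * √L) ^ 2 * (n * d * κ) := by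
    have : lam * (σ / lam * √(n * d * κ) * √L) = σ * √L * √(n * d * κ) := by field_simp
    rw [this, mul_pow _ (√(n * d * κ)), Real.sq_sqrt (h4.trans h3)]
  rw [h5, mul_pow]
  exact h2.trans (h1.trans (mul_le_mul_of_nonneg_left h3 (sq_nonneg _)))

end Error

/-! ### Comparison of confidence parameters -/

section Scalars

variable {B σ lam C δ : ℝ} {p n d : ℕ}

lemma log_three_mul_div_ge_one (hn : 1 ≤ n) (hδ : 0 < δ) (hδ1 : δ < 1) :
    1 ≤ Real.log (3 * n / δ) := by
  have hn1 : (1 : ℝ) ≤ n := by exact_mod_cast hn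
  rw [Real.le_log_iff_exp_le (by positivity), le_div_iff₀ hδ]
  have := Real.exp_one_lt_three
  nlinarith [Real.exp_pos 1]

lemma log_four_mul_div_le (hn : 1 ≤ n) (hd : 1 ≤ d) (hδ : 0 < δ) (hδ1 : δ < 1) :
    Real.log (2 / (δ / 2 / (n * d))) ≤ 2 * d * Real.log (3 * n / δ) := by
  have hn1 : (1 : ℝ) ≤ n := by exact_mod_cast hn
  have hd1 : (1 : ℝ) ≤ d := by exact_mod_cast hd
  have h := log_three_mul_div_ge_one hn hδ hδ1
  -- Separates the logarithm occurring in `β(2δ/(3n))`, which is at least 1, from a surplus `log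
  -- (4d/3) ≤ 4d/3 - 1`.
  have h1 : 2 / (δ / 2 / (n * d)) = 3 * n / δ * (4 * d / 3) := by field_simp; ring
  rw [h1, Real.log_mul (by positivity) (by positivity)]
  have h2 := Real.log_le_sub_one_of_pos (show (0 : ℝ) < 4 * d / 3 by positivity)
  nlinarith

lemma beta_two_mul_div (hn : 1 ≤ n) (hδ : 0 < δ) :
    beta B σ lam (2 * δ / (3 * n)) = B + σ / lam * √(2 * Real.log (3 * n / δ)) := by
  have hn1 : (1 : ℝ) ≤ n := by exact_mod_cast hn
  rw [beta]
  congr 5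
  field_simp

/-- The radius that the union bound yields exceeds the one built into `β_n(δ)` by a factor of at
most `2d`. -/
lemma norm_bound_le (hB : 0 < B) (hσ : 0 < σ) (hlam : 0 < lam) (hn : 1 ≤ n) (hd : 1 ≤ d)
    (hδ : 0 < δ) (hδ1 : δ < 1) :
    2 * B + σ / lam * √(n * d) * √(2 * Real.log (2 / (δ / 2 / (n * d)))) ≤
      2 * d * (B + √n * beta B σ lam (2 * δ / (3 * n))) := by
  have hd1 : (1 : ℝ) ≤ d := by exact_mod_cast hd
  have h := log_three_mul_div_ge_one hn hδ hδ1
  have h1 := log_four_mul_div_le hn hd hδ hδ1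
  rw [beta_two_mul_div hn hδ]
  have h2 : √(n * d) * √(2 * Real.log (2 / (δ / 2 / (n * d)))) ≤
      2 * d * (√n * √(2 * Real.log (3 * n / δ))) := by
    rw [← Real.sqrt_mul (by positivity), ← Real.sqrt_mul (by positivity)]
    refine Real.sqrt_le_iff.2 ⟨by positivity, ?_⟩
    rw [mul_pow, Real.sq_sqrt (by positivity)]
    have : (n : ℝ) * d * (2 * Real.log (2 / (δ / 2 / (n * d)))) ≤
      n * d * (2 * (2 * d * Real.log (3 * n / δ))) := by gcongr
    refine this.trans ?_
    have : 0 ≤ (n : ℝ) * d * d * Real.log (3 * n / δ) := by positivity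
    nlinarith
  have h3 : σ / lam * √(n * d) * √(2 * Real.log (2 / (δ / 2 / (n * d)))) ≤
      σ / lam * (2 * d * (√n * √(2 * Real.log (3 * n / δ)))) := by
    rw [mul_assoc]
    gcongr
  have h4 : 0 ≤ √(n : ℝ) * B := by positivity
  have h5 : 2 * B ≤ 2 * d * B := by nlinarith
  have h6 : 0 ≤ 2 * d * (√(n : ℝ) * B) := by positivity
  nlinarith

/-- The size of the discretization inside `β_n(δ)`. -/
lemma size_ge (hB : 0 < B) (hσ : 0 < σ) (hlam : 0 < lam) (hn : 1 ≤ n) (hC : 1 ≤ C * B ^ p) :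
    (2 : ℝ) ^ p ≤ C * (B + √n * beta B σ lam (2 * δ / (3 * n))) ^ p * √n ^ p ∧
      (n : ℝ) ^ p ≤ C * (B + √n * beta B σ lam (2 * δ / (3 * n))) ^ p * √n ^ p := by
  have hn1 : (1 : ℝ) ≤ n := by exact_mod_cast hn
  have hs : 1 ≤ √(n : ℝ) := Real.one_le_sqrt.2 hn1
  have hC0 : 0 < C := pos_of_mul_pos_left (one_pos.trans_le hC) (by positivity)
  have hb : B ≤ beta B σ lam (2 * δ / (3 * n)) := le_add_of_nonneg_right (by positivity)
  set β := beta B σ lam (2 * δ / (3 * n))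
  have h2 : (2 * B) ^ p ≤ (B + √n * β) ^ p * √n ^ p := by
    rw [← mul_pow]
    refine pow_le_pow_left₀ (by positivity) ?_ p
    have : B ≤ √n * β := by nlinarith
    nlinarith
  have h3 : (n * B) ^ p ≤ (B + √n * β) ^ p * √n ^ p := by
    rw [← mul_pow]
    refine pow_le_pow_left₀ (by positivity) ?_ p
    have hnn : √(n : ℝ) * √n = n := Real.mul_self_sqrt (by positivity)
    calc (n : ℝ) * B = B * √n * √n := by rw [mul_assoc, hnn, mul_comm]
      _ ≤ _ := by
        refine mul_le_mul_of_nonneg_right ?_ (by positivity)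
        nlinarith
  rw [mul_pow] at h2 h3
  rw [mul_assoc]
  constructor
  · calc (2 : ℝ) ^ p ≤ 2 ^ p * (C * B ^ p) := le_mul_of_one_le_right (by positivity) hC
      _ = C * (2 ^ p * B ^ p) := by ring
      _ ≤ _ := by gcongr
  · calc (n : ℝ) ^ p ≤ n ^ p * (C * B ^ p) := le_mul_of_one_le_right (by positivity) hC
      _ = C * (n ^ p * B ^ p) := by ring
      _ ≤ _ := by gcongr

lemma log_six_mul_ge {M : ℝ} (hM : (2 : ℝ) ^ p ≤ M) (hδ : 0 < δ) (hδ1 : δ < 1) :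
    1 + p / 2 ≤ Real.log (2 / (δ / (3 * M))) := by
  have hM0 : 0 < M := lt_of_lt_of_le (by positivity) hM
  have h1 : (3 : ℝ) * 2 ^ p ≤ 2 / (δ / (3 * M)) := by
    have : 2 / (δ / (3 * M)) = 6 * M / δ := by field_simp; ring
    rw [this, le_div_iff₀ hδ]
    nlinarith [pow_pos (two_pos (α := ℝ)) p]
  refine le_trans ?_ (Real.log_le_log (by positivity) h1)
  rw [Real.log_mul (by positivity) (by positivity), Real.log_pow]
  have h3 : 1 ≤ Real.log 3 := by
    rw [Real.le_log_iff_exp_le (by positivity)]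
    exact Real.exp_one_lt_three.le
  have := Real.log_two_gt_d9
  have hp : (0 : ℝ) ≤ p := by positivity
  nlinarith

/-- The larger radius and the `d` outputs multiply the argument of the logarithm by at most
`(2d)^(p+1)`. As `p + 1 ≤ 2R` by `log_six_mul_ge`, this costs a factor linear in `d` and independent
of `p`. -/
lemma log_union_le {b b' q : ℝ} (hd : 1 ≤ d) (hb' : 0 < b') (hbb : b' ≤ 2 * d * b) (hC : 0 < C)
    (hq : 0 < q) (hM : (2 : ℝ) ^ p ≤ C * b ^ p * q) (hδ : 0 < δ) (hδ1 : δ < 1) :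
    Real.log (2 / (δ / 2 / (C * b' ^ p * q * d))) ≤
      4 * d * Real.log (2 / (δ / (3 * (C * b ^ p * q)))) := by
  have hd1 : (1 : ℝ) ≤ d := by exact_mod_cast hd
  have hR := log_six_mul_ge hM hδ hδ1
  have hp : (0 : ℝ) ≤ p := by positivity
  have hM0 : 0 < C * b ^ p * q := lt_of_lt_of_le (by positivity) hM
  set R := Real.log (2 / (δ / (3 * (C * b ^ p * q)))) with hRdef
  have h1 : 2 / (δ / 2 / (C * b' ^ p * q * d)) ≤
      2 / (δ / (3 * (C * b ^ p * q))) * (2 * d) ^ (p + 1) := by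
    have h2 : b' ^ p ≤ (2 * d) ^ p * b ^ p := by
      rw [← mul_pow]
      exact pow_le_pow_left₀ hb'.le hbb p
    have e1 : 2 / (δ / 2 / (C * b' ^ p * q * d)) = 4 * d * (C * q) / δ * b' ^ p := by
      field_simp; ring
    have e2 : 2 / (δ / (3 * (C * b ^ p * q))) * (2 * d) ^ (p + 1) =
        12 * d * (C * q) / δ * ((2 * d) ^ p * b ^ p) := by
      have hbp : b ^ p ≠ 0 := by
        intro h0
        simp [h0] at hM0
      field_simp; ring
    rw [e1, e2]
    have h4 : 4 * d * (C * q) / δ ≤ 12 * d * (C * q) / δ := by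
      gcongr
      norm_num
    exact mul_le_mul h4 h2 (by positivity) (by positivity)
  refine (Real.log_le_log (by positivity) h1).trans ?_
  rw [Real.log_mul (by positivity) (by positivity), Real.log_pow, ← hRdef]
  have h5 := Real.log_le_sub_one_of_pos (show (0 : ℝ) < 2 * d by positivity)
  have h6 : ((p + 1 : ℕ) : ℝ) * Real.log (2 * d) ≤ (2 * R) * (2 * d - 1) := by
    push_cast
    exact mul_le_mul (by linarith) h5 (Real.log_nonneg (by linarith)) (by linarith)
  nlinarith

lemma log_four_mul_div_le_of_size {M : ℝ} (hn : 1 ≤ n) (hd : 1 ≤ d) (hδ : 0 < δ) (hδ1 : δ < 1)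
    (hM : (2 : ℝ) ^ p ≤ M) (hnM : (n : ℝ) ≤ M) :
    Real.log (2 / (δ / 2 / (n * d))) ≤ d * Real.log (2 / (δ / (3 * M))) := by
  have hn1 : (1 : ℝ) ≤ n := by exact_mod_cast hn
  have hd1 : (1 : ℝ) ≤ d := by exact_mod_cast hd
  have hM0 : 0 < M := lt_of_lt_of_le (by positivity) hM
  have hR := log_six_mul_ge hM hδ hδ1
  have h1 : 2 / (δ / 2 / (n * d)) ≤ 2 / (δ / (3 * M)) * d := by
    have e1 : 2 / (δ / 2 / (n * d)) = 4 * n / δ * d := by field_simp; ring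
    have e2 : 2 / (δ / (3 * M)) = 6 * M / δ := by field_simp; ring
    rw [e1, e2]
    gcongr
    linarith
  refine (Real.log_le_log (by positivity) h1).trans ?_
  rw [Real.log_mul (by positivity) (by positivity)]
  have h2 := Real.log_le_sub_one_of_pos (show (0 : ℝ) < d by positivity)
  have hp : (0 : ℝ) ≤ p := by positivity
  nlinarith

end Scalars

/-! ### The pieces of the error and the common rate -/

section Bound

open scoped InnerProductSpace

lemma norm_le_mul_sqrt_sum {ι : Type*} [Fintype ι] {e : EuclideanSpace ℝ ι} {s : ι → ℝ} {c : ℝ}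
    (hc : 0 ≤ c) (hs : ∀ l, 0 ≤ s l) (h : ∀ l, |e l| ≤ c * √(s l)) : ‖e‖ ≤ c * √(∑ l, s l) := by
  rw [EuclideanSpace.norm_eq, ← Real.sqrt_sq hc, ← Real.sqrt_mul (sq_nonneg c), Finset.mul_sum]
  refine Real.sqrt_le_sqrt (Finset.sum_le_sum fun l _ => ?_)
  have := pow_le_pow_left₀ (abs_nonneg _) (h l) 2
  rwa [mul_pow, Real.sq_sqrt (hs l)] at this

lemma norm_le_sqrt_mul {d : ℕ} {e : EuclideanSpace ℝ (Fin d)} {c : ℝ}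
    (hc : 0 ≤ c) (h : ∀ l, |e l| ≤ c) : ‖e‖ ≤ √d * c := by
  have := norm_le_mul_sqrt_sum (s := fun _ => 1) hc (fun _ => zero_le_one) (by simpa using h)
  rw [mul_comm]
  simpa using this

variable {X : Type*} {d : ℕ} {E : Type*} [NormedAddCommGroup E] [InnerProductSpace ℝ E]
  {k : X × Fin d → X × Fin d → ℝ} {φ : X × Fin d → E} {lam : ℝ}

lemma norm_error_le_of_noise (hφ : ∀ z w, ⟪φ z, φ w⟫_ℝ = k z w) (hlam : 0 < lam) {x : ℕ → X}
    {n : ℕ} {g : E} {v : Fin n × Fin d → ℝ} {B σ L : ℝ} (hg : ‖g‖ ≤ B) (hσ : 0 < σ) {u : X}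
    (hv : ∀ l, |ridge k lam x n (kvec k x n (u, l)) ⬝ᵥ v| ≤
      σ * √(ridge k lam x n (kvec k x n (u, l)) ⬝ᵥ ridge k lam x n (kvec k x n (u, l))) * √L)
    {e : EuclideanSpace ℝ (Fin d)}
    (he : ∀ l, e l = ⟪errorVec k φ lam x n g v, φ (u, l)⟫_ℝ) :
    ‖e‖ ≤ (B + σ / lam * √lam * √L) * √(∑ l, postCov k lam x n (u, l) (u, l)) := by
  have hB := (norm_nonneg g).trans hg
  refine norm_le_mul_sqrt_sum (by positivity) (fun l => postCov_nonneg hφ hlam x n _) fun l => ?_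
  rw [he, inner_errorVec hφ]
  refine (abs_error_le hφ hlam x n g v (u, l)).trans ?_
  rw [add_mul]
  refine add_le_add (by gcongr) ((hv l).trans ?_)
  have h1 := mul_ridge_dotProduct_self_le hφ hlam x n (u, l)
  set c := ridge k lam x n (kvec k x n (u, l))
  have h2 : √lam * √(c ⬝ᵥ c) ≤ √(postCov k lam x n (u, l) (u, l)) := by
    rw [← Real.sqrt_mul hlam.le]
    exact Real.sqrt_le_sqrt h1
  have h3 : √lam * √lam = lam := Real.mul_self_sqrt hlam.le
  -- The natural factor is `σ/√λ`; it is written as `(σ/λ)√λ` to match `β`, which puts `√λ` into the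
  -- final constant.
  calc σ * √(c ⬝ᵥ c) * √L = σ / lam * √lam * √L * (√lam * √(c ⬝ᵥ c)) := by
        have : σ = σ / lam * (√lam * √lam) := by rw [h3]; field_simp
        conv_lhs => rw [this]
        ring
    _ ≤ _ := by gcongr

lemma norm_error_le_of_norm (hφ : ∀ z w, ⟪φ z, φ w⟫_ℝ = k z w) {κ s : ℝ}
    (hκ : ∀ z, k z z ≤ κ) {h : E} (hs : ‖h‖ ≤ s) {u : X} {e : EuclideanSpace ℝ (Fin d)}
    (he : ∀ l, e l = ⟪h, φ (u, l)⟫_ℝ) : ‖e‖ ≤ √d * (s * √κ) := by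
  have hs0 := (norm_nonneg h).trans hs
  refine norm_le_sqrt_mul (by positivity) fun l => ?_
  rw [he]
  refine (abs_real_inner_le_norm _ _).trans (mul_le_mul hs ?_ (norm_nonneg _) hs0)
  refine Real.le_sqrt_of_sq_le ?_
  rw [← real_inner_self_eq_norm_sq, hφ]
  exact hκ _

variable {p n : ℕ} {B σ C δ : ℝ}

lemma betaN_eq (B σ lam C δ : ℝ) (p n : ℕ) :
    betaN B σ lam C p n δ = 3 * B + σ / lam * √(2 * Real.log (2 / (δ / (3 * (C *
      (B + √n * beta B σ lam (2 * δ / (3 * n))) ^ p * √n ^ p))))) := by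
  rw [betaN, Real.rpow_div_two_eq_sqrt _ (Nat.cast_nonneg n), Real.rpow_natCast, beta]
  simp only [mul_assoc]
  ring

/-- A term of the order of the discretization error, or of the statistical error. -/
noncomputable def rate (lam : ℝ) (d n : ℕ) (β Γ : ℝ) : ℝ :=
  d * β * (√Γ / (√n * √(Real.log (1 + 1 / lam))))

lemma rate_nonneg {β Γ : ℝ} (hβ : 0 ≤ β) : 0 ≤ rate lam d n β Γ := by
  unfold rate
  positivity

/-- The factor `d` of the rate arises as `√d · √d`: one from the summed variance, one from the
enlarged logarithm. -/
lemma statistical_le_rate (hlam : 0 < lam) (hn : 1 ≤ n) (hB : 0 ≤ B) (hσ : 0 < σ) (hd : 1 ≤ d)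
    {V Γ ℓ ℓ' : ℝ} (hℓ : 0 ≤ ℓ)
    (hV : n * V * Real.log (1 + 1 / lam) ≤ 4 * d * Γ) (hℓ' : ℓ' ≤ 4 * d * ℓ) :
    (B + σ / lam * √lam * √(2 * ℓ')) * √V ≤
      2 * (1 + 2 * √lam) * rate lam d n (3 * B + σ / lam * √(2 * ℓ)) Γ := by
  have hA : 0 < Real.log (1 + 1 / lam) := Real.log_pos (by simp [hlam])
  have hn0 : (0 : ℝ) < n := by exact_mod_cast hn
  have hd1 : (1 : ℝ) ≤ d := by exact_mod_cast hd
  set A := Real.log (1 + 1 / lam)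
  have h1 : √V ≤ 2 * √d * (√Γ / (√n * √A)) := by
    rw [mul_div_assoc', le_div_iff₀ (by positivity), ← Real.sqrt_mul hn0.le,
      show 2 * √(d : ℝ) * √Γ = √(4 * d * Γ) by
        rw [Real.sqrt_mul (by positivity), Real.sqrt_mul (by positivity)]
        congr 2
        rw [show (4 : ℝ) = 2 ^ 2 by norm_num, Real.sqrt_sq (by norm_num)],
      ← Real.sqrt_mul' _ (by positivity)]
    exact Real.sqrt_le_sqrt (by linarith)
  have h2 : √(2 * ℓ') ≤ 2 * √d * √(2 * ℓ) := by
    refine Real.sqrt_le_iff.2 ⟨by positivity, ?_⟩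
    rw [mul_pow, mul_pow, Real.sq_sqrt (by positivity), Real.sq_sqrt (by positivity)]
    linarith
  have hsd : 1 ≤ √(d : ℝ) := Real.one_le_sqrt.2 hd1
  have h3 : B + σ / lam * √lam * √(2 * ℓ') ≤
      (1 + 2 * √lam) * √d * (3 * B + σ / lam * √(2 * ℓ)) := by
    have h4 : σ / lam * √lam * √(2 * ℓ') ≤ σ / lam * √lam * (2 * √d * √(2 * ℓ)) := by gcongr
    have h5 : B ≤ (1 + 2 * √lam) * √d * (3 * B) := by
      have : 1 ≤ (1 + 2 * √lam) * √d :=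
        one_le_mul_of_one_le_of_one_le (by linarith [Real.sqrt_nonneg lam]) hsd
      nlinarith
    have h6 : 0 ≤ √(d : ℝ) * (σ / lam * √(2 * ℓ)) := by positivity
    nlinarith
  calc _ ≤ ((1 + 2 * √lam) * √d * (3 * B + σ / lam * √(2 * ℓ))) *
        (2 * √d * (√Γ / (√n * √A))) := by gcongr
    _ = 2 * (1 + 2 * √lam) * ((√d * √d) * (3 * B + σ / lam * √(2 * ℓ)) * (√Γ / (√n * √A))) := by
        ring
    _ = _ := by rw [Real.mul_self_sqrt (by positivity), rate]

/-- Both `β / B` and `2√Γ / √(log (1 + 1/λ))` are at least 1, so they can be inserted freely; hence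
the `2 / B` in the constant. -/
lemma discretization_le_rate (hlam : 0 < lam) (hn : 1 ≤ n) (hB : 0 < B) (hd : 1 ≤ d)
    {β Γ : ℝ} (hβ : B ≤ β) (hΓ : Real.log (1 + 1 / lam) ≤ 2 * Γ) :
    √d * (1 / √n) ≤ 2 / B * rate lam d n β Γ := by
  have hA : 0 < Real.log (1 + 1 / lam) := Real.log_pos (by simp [hlam])
  have hn0 : (0 : ℝ) < n := by exact_mod_cast hn
  have hd1 : (1 : ℝ) ≤ d := by exact_mod_cast hd
  unfold rate
  set A := Real.log (1 + 1 / lam)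
  have h1 : √A ≤ 2 * √Γ := by
    refine Real.sqrt_le_iff.2 ⟨by positivity, ?_⟩
    rw [mul_pow, Real.sq_sqrt (by linarith)]
    linarith
  have h2 : √(d : ℝ) ≤ d := Real.sqrt_le_iff.2 ⟨by positivity, by nlinarith⟩
  have h3 : 2 / B * (d * β * (√Γ / (√n * √A))) = d * (1 / √n) * ((β / B) * (2 * √Γ / √A)) := by
    field_simp
  rw [h3]
  have h4 : 1 ≤ β / B := by rwa [le_div_iff₀ hB, one_mul]
  have h5 : 1 ≤ 2 * √Γ / √A := by rwa [le_div_iff₀ (by positivity), one_mul]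
  calc √(d : ℝ) * (1 / √n) ≤ d * (1 / √n) := by gcongr
    _ ≤ _ := le_mul_of_one_le_right (by positivity) (one_le_mul_of_one_le_of_one_le h4 h5)

/-- For a tiny kernel, `√κ` itself is of order `√(Γ/(nd))`, and `ndκ ≤ 1` removes the growth in `n`
of the noise norm apart from the logarithm. -/
lemma small_kernel_le_rate (hlam : 0 < lam) (hn : 1 ≤ n) (hB : 0 ≤ B) (hσ : 0 < σ) (hd : 1 ≤ d)
    {κ Γ ℓ ℓ' : ℝ} (hκ : 0 ≤ κ) (hκ1 : n * d * κ ≤ 1)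
    (hΓ : n * d * κ * Real.log (1 + 1 / lam) ≤ 2 * Γ) (hℓ' : ℓ' ≤ d * ℓ) :
    √d * ((2 * B + σ / lam * √(n * d * κ) * √(2 * ℓ')) * √κ) ≤
      2 * rate lam d n (3 * B + σ / lam * √(2 * ℓ)) Γ := by
  have hA : 0 < Real.log (1 + 1 / lam) := Real.log_pos (by simp [hlam])
  have hn0 : (0 : ℝ) < n := by exact_mod_cast hn
  have hd1 : (1 : ℝ) ≤ d := by exact_mod_cast hd
  unfold rate
  set A := Real.log (1 + 1 / lam)
  have hsd : 1 ≤ √(d : ℝ) := Real.one_le_sqrt.2 hd1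
  have h1 : √d * √κ ≤ 2 * (√Γ / (√n * √A)) := by
    rw [mul_div_assoc', le_div_iff₀ (by positivity), ← Real.sqrt_mul (by positivity),
      ← Real.sqrt_mul (by positivity), ← Real.sqrt_mul (by positivity)]
    have hΓ0 : 0 ≤ Γ := by
      have : 0 ≤ n * d * κ * A := by positivity
      linarith
    refine Real.sqrt_le_iff.2 ⟨by positivity, ?_⟩
    rw [mul_pow, Real.sq_sqrt hΓ0]
    linarith
  have h2 : √(2 * ℓ') ≤ √d * √(2 * ℓ) := by
    rw [← Real.sqrt_mul (by positivity)]
    exact Real.sqrt_le_sqrt (by linarith)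
  have h3 : 2 * B + σ / lam * √(n * d * κ) * √(2 * ℓ') ≤ d * (3 * B + σ / lam * √(2 * ℓ)) := by
    have h4 : σ / lam * √(n * d * κ) * √(2 * ℓ') ≤ σ / lam * 1 * (√d * √(2 * ℓ)) := by
      have := Real.sqrt_le_one.2 hκ1
      gcongr
    have h5 : √(d : ℝ) ≤ d := Real.sqrt_le_iff.2 ⟨by positivity, by nlinarith⟩
    have h6 : √(d : ℝ) * (σ / lam * √(2 * ℓ)) ≤ d * (σ / lam * √(2 * ℓ)) := by gcongr
    nlinarith
  calc _ = (2 * B + σ / lam * √(n * d * κ) * √(2 * ℓ')) * (√d * √κ) := by ring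
    _ ≤ (d * (3 * B + σ / lam * √(2 * ℓ))) * (2 * (√Γ / (√n * √A))) := by gcongr
    _ = _ := by ring

end Bound

/-! ### Assembly of the bound -/

section Main

open scoped InnerProductSpace

variable {X : Type*} {d : ℕ} {E : Type*} [NormedAddCommGroup E] [InnerProductSpace ℝ E]
  {k : X × Fin d → X × Fin d → ℝ} {φ : X × Fin d → E} {lam : ℝ}
  {p n : ℕ} {B σ C δ : ℝ}

/-- The error bound on the event that the noise is small in the relevant directions. -/
lemma norm_error_le [TopologicalSpace X] [CompactSpace X]
    (hk : Continuous fun q : (X × Fin d) × (X × Fin d) => k q.1 q.2) (hk1 : ∀ z w, k z w ≤ 1)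
    (hφ : ∀ z w, ⟪φ z, φ w⟫_ℝ = k z w) (hlam : 0 < lam) (hB : 0 < B) (hσ : 0 < σ)
    (hn : 1 ≤ n) (hd : 1 ≤ d) (hδ : 0 < δ) (hδ1 : δ < 1) (hC : 1 ≤ C * B ^ p)
    {x : ℕ → X} (hx : IsMVRRun k lam n x) {g : E} (hg : ‖g‖ ≤ B)
    {D : Set X} {r : X → X} (hr : ∀ u, r u ∈ D) (hp : p = 0 → ∀ u, r u = u)
    {b' : ℝ} (hb' : b' = 2 * B + σ / lam * √(n * d) * √(2 * Real.log (2 / (δ / 2 / (n * d)))))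
    (hdisc : ∀ h : E, ‖h‖ ≤ b' → ∀ u i, ⟪h, φ (u, i)⟫_ℝ - ⟪h, φ (r u, i)⟫_ℝ ≤ 1 / √n)
    {A : Matrix (Fin n × Fin d) (Fin n × Fin d) ℝ} (hA : gram k x n = Aᴴ * A)
    {v : Fin n × Fin d → ℝ}
    (hv1 : ∀ j, |A j ⬝ᵥ v| ≤
      σ * √(A j ⬝ᵥ A j) * √(2 * Real.log (2 / (δ / 2 / (n * d)))))
    (hv2 : ∀ u ∈ D, ∀ l, |ridge k lam x n (kvec k x n (u, l)) ⬝ᵥ v| ≤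
      σ * √(ridge k lam x n (kvec k x n (u, l)) ⬝ᵥ ridge k lam x n (kvec k x n (u, l))) *
        √(2 * Real.log (2 / (δ / 2 / (C * b' ^ p * √n ^ p * d)))))
    {u : X} {e : EuclideanSpace ℝ (Fin d)}
    (he : ∀ l, e l = ⟪errorVec k φ lam x n g v, φ (u, l)⟫_ℝ) :
    ‖e‖ ≤ (2 * (1 + 2 * √lam) + 2 / B + 2) *
      rate lam d n (betaN B σ lam C p n δ) (maxInfoGain k lam (n * d)) := by
  have hn1 : (1 : ℝ) ≤ n := by exact_mod_cast hn
  have hd1 : (1 : ℝ) ≤ d := by exact_mod_cast hd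
  have hs1 : 1 ≤ √(n : ℝ) := Real.one_le_sqrt.2 hn1
  have hC0 : 0 < C := pos_of_mul_pos_left (one_pos.trans_le hC) (by positivity)
  have : Nonempty (X × Fin d) := ⟨(u, ⟨0, hd⟩)⟩
  obtain ⟨z₀, -, hz₀⟩ := isCompact_univ.exists_isMaxOn (Set.univ_nonempty (α := X × Fin d))
    (f := fun z => k z z) (hk.comp (continuous_id.prodMk continuous_id)).continuousOn
  have hκ : ∀ z, k z z ≤ k z₀ z₀ := fun z => hz₀ (Set.mem_univ z)
  have hκ0 : 0 ≤ k z₀ z₀ := by rw [← hφ]; exact real_inner_self_nonneg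
  have hκ1 := hk1 z₀ z₀
  have hκΓ := log_one_add_le_maxInfoGain hk hφ hlam (n * d) z₀
  have hVΓ := fun u => IsMVRRun.sum_postCov_le hk hk1 hφ hlam hn hd hx u
  set κ := k z₀ z₀
  set Γ := maxInfoGain k lam (n * d)
  obtain ⟨hM2, hMn⟩ := size_ge (δ := δ) hB hσ hlam hn hC
  have hbb := norm_bound_le hB hσ hlam hn hd hδ hδ1
  rw [← hb'] at hbb
  have hb'0 : 0 < b' := by rw [hb']; positivity
  have hlog2 := log_union_le hd hb'0 hbb hC0 (show 0 < √(n : ℝ) ^ p by positivity) hM2 hδ hδ1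
  have hlog := log_six_mul_ge hM2 hδ hδ1
  have hlog1 := fun h => log_four_mul_div_le_of_size hn hd hδ hδ1 hM2 h
  have hβ := betaN_eq B σ lam C δ p n
  set M := C * (B + √n * beta B σ lam (2 * δ / (3 * n))) ^ p * √n ^ p
  set ℓ := Real.log (2 / (δ / (3 * M)))
  have hℓ : 0 ≤ ℓ := le_trans (by positivity) hlog
  set β := betaN B σ lam C p n δ
  have hβB : B ≤ β := by
    have : 0 ≤ σ / lam * √(2 * ℓ) := by positivity
    linarith
  have hrate : 0 ≤ rate lam d n β Γ := rate_nonneg (hB.le.trans hβB)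
  have hnoise := norm_featureSum_ridge_noise_le hφ hlam hκ hA hσ hv1
  have hvec := norm_errorVec_le hφ hlam x n g v
  set h := errorVec k φ lam x n g v
  have hh : ‖h‖ ≤
      2 * B + σ / lam * √(n * d * κ) * √(2 * Real.log (2 / (δ / 2 / (n * d)))) := by
    linarith
  have hhb : ‖h‖ ≤ b' := by
    refine hh.trans ?_
    rw [hb']
    exact add_le_add le_rfl (mul_le_mul_of_nonneg_right (mul_le_mul_of_nonneg_left
      (Real.sqrt_le_sqrt (mul_le_of_le_one_right (by positivity) hκ1)) (by positivity))
      (by positivity))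
  have hstat : ‖(WithLp.toLp 2 fun l => ⟪h, φ (r u, l)⟫_ℝ : EuclideanSpace ℝ (Fin d))‖ ≤
      2 * (1 + 2 * √lam) * rate lam d n β Γ := by
    refine (norm_error_le_of_noise hφ hlam hg hσ (hv2 (r u) (hr u)) fun l => rfl).trans ?_
    rw [hβ]
    exact statistical_le_rate hlam hn hB.le hσ hd hℓ (hVΓ (r u)) hlog2
  have hB2 : 0 ≤ 2 / B * rate lam d n β Γ := by positivity
  have hstat0 : 0 ≤ 2 * (1 + 2 * √lam) * rate lam d n β Γ := by positivity
  rcases Nat.eq_zero_or_pos p with hp0 | hp0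
  · have hee : e = WithLp.toLp 2 fun l => ⟪h, φ (r u, l)⟫_ℝ := by
      ext l
      rw [he, hp hp0]
    rw [hee]
    linarith
  -- No positive lower bound on `Γ` is available when the kernel is small, so that case avoids the
  -- discretization; `p ≥ 1` enters there through `n ≤ n^p ≤ M`.
  rcases le_total ((n : ℝ) * d * κ) 1 with hsmall | hlarge
  · have hnM : (n : ℝ) ≤ M := by
      refine le_trans ?_ hMn
      exact le_self_pow₀ hn1 hp0.ne'
    have h1 := norm_error_le_of_norm hφ hκ hh he
    have h2 := mul_log_one_add_inv_le hlam (by positivity) hsmall le_rfl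
    have h3 := small_kernel_le_rate (Γ := Γ) hlam hn hB.le hσ hd hκ0 hsmall
      (h2.trans (by push_cast at hκΓ; linarith)) (hlog1 hnM)
    rw [← hβ] at h3
    linarith
  · have hΓ : Real.log (1 + 1 / lam) ≤ 2 * Γ := by
      have : Real.log (1 + 1 / lam) ≤ Real.log (1 + (n * d : ℕ) * κ / lam) := by
        refine Real.log_le_log (by positivity) ?_
        push_cast
        gcongr
      linarith
    have hdiff : ‖e - WithLp.toLp 2 fun l => ⟪h, φ (r u, l)⟫_ℝ‖ ≤ √d * (1 / √n) := by
      refine norm_le_sqrt_mul (by positivity) fun l => ?_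
      -- The assumption is one-sided; applying it to `h` and `-h` gives the absolute value.
      have h1 := hdisc h hhb u l
      have h2 := hdisc (-h) (by rwa [norm_neg]) u l
      simp only [inner_neg_left] at h2
      rw [PiLp.sub_apply, he, abs_le]
      constructor <;> linarith
    have h1 := discretization_le_rate hlam hn hB hd hβB hΓ
    have h2 := norm_sub_norm_le e (WithLp.toLp 2 fun l => ⟪h, φ (r u, l)⟫_ℝ)
    linarith

lemma ofReal_one_sub_le_of_bad {Ω : Type*} [MeasurableSpace Ω] {P : Measure Ω}
    [IsProbabilityMeasure P] {s b₁ b₂ : Set Ω} {δ : ℝ} (hδ : 0 < δ)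
    (h1 : P b₁ ≤ ENNReal.ofReal (δ / 2)) (h2 : P b₂ ≤ ENNReal.ofReal (δ / 2))
    (hs : ∀ w, w ∉ b₁ → w ∉ b₂ → w ∈ s) : ENNReal.ofReal (1 - δ) ≤ P s := by
  have h : (1 : ENNReal) ≤ P s + ENNReal.ofReal δ := by
    calc (1 : ENNReal) = P Set.univ := measure_univ.symm
      _ ≤ P (s ∪ (b₁ ∪ b₂)) := measure_mono fun w _ => by
        by_cases hw1 : w ∈ b₁
        · exact Or.inr (Or.inl hw1)
        by_cases hw2 : w ∈ b₂
        · exact Or.inr (Or.inr hw2)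
        exact Or.inl (hs w hw1 hw2)
      _ ≤ P s + (P b₁ + P b₂) :=
        (measure_union_le _ _).trans (add_le_add_right (measure_union_le _ _) _)
      _ ≤ P s + (ENNReal.ofReal (δ / 2) + ENNReal.ofReal (δ / 2)) := by gcongr
      _ = P s + ENNReal.ofReal δ := by
        rw [← ENNReal.ofReal_add (by positivity) (by positivity), add_halves]
  rw [ENNReal.ofReal_sub _ hδ.le, ENNReal.ofReal_one]
  exact tsub_le_iff_right.2 h

end Main

end MVR

theorem lemma1 (lam B : ℝ) (hlam : 0 < lam) (hB : 0 < B) :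
    -- the constant of the `O`-notation: it depends on `λ` and `B` only
    ∃ K : ℝ, 0 < K ∧
      -- the set `X ⊆ ℝ^p` of state-action pairs, and the output dimension `d`
      ∀ (p d : ℕ) (X : Set (EuclideanSpace ℝ (Fin p))) (_ : IsCompact X)
        -- the kernel and its RKHS
        (k : X × Fin d → X × Fin d → ℝ)
        (_ : Continuous fun q : (X × Fin d) × (X × Fin d) => k q.1 q.2)
        (_ : ∀ z w, k z w ≤ 1)
        (H : Type*) [NormedAddCommGroup H] [InnerProductSpace ℝ H] [CompleteSpace H]
        [RKHS ℝ H (X × Fin d) ℝ] (_ : MVR.IsRKHSOf k H)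
        (C : ℝ) (_ : MVR.Discretizable X H C B)
        -- the unknown dynamics `f = (F(·,1), …, F(·,d))`
        (F : H) (_ : ‖F‖ ≤ B)
        (f : X → EuclideanSpace ℝ (Fin d)) (_ : ∀ u l, f u l = F (u, l))
        -- the transition noise
        (σ : ℝ) (_ : 0 < σ)
        (Ω : Type*) [MeasurableSpace Ω] (P : Measure Ω) [IsProbabilityMeasure P]
        (ω : ℕ → Ω → EuclideanSpace ℝ (Fin d))
        (_ : iIndepFun ω P)
        (_ : ∀ t, HasLaw (ω t) (multivariateGaussian 0 (σ ^ 2 • (1 : Matrix (Fin d) (Fin d) ℝ))) P)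
        -- a run of the algorithm
        (n : ℕ) (_ : 1 ≤ n) (x : ℕ → X) (_ : MVR.IsMVRRun k lam n x)
        (δ : ℝ) (_ : 0 < δ) (_ : δ < 1),
        ENNReal.ofReal (1 - δ) ≤
          P {w | ∀ u : X,
            ‖MVR.postMean k lam x (fun t => f (x t) + ω t w) n u - f u‖ ≤
              K * (MVR.betaN B σ lam C p n δ * (2 * Real.exp 1 * d) / √(n : ℝ) *
                √(MVR.maxInfoGain k lam (n * d)))} := by
  have hlog : 0 < Real.log (1 + 1 / lam) := Real.log_pos (by simp [hlam])
  -- The summands pay for the statistical error, the discretization error and the small-kernel case;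
  -- the denominator comes from the variance decay.
  refine ⟨(2 * (1 + 2 * √lam) + 2 / B + 2) / √(Real.log (1 + 1 / lam)), by positivity, ?_⟩
  intro p d X hX k hk hk1 H _ _ _ _ hH C hdis F hF f hf σ hσ Ω _ P _ ω hindep hω n hn x hx
    δ hδ hδ1
  have : CompactSpace X := isCompact_iff_compactSpace.1 hX
  rcases Nat.eq_zero_or_pos d with rfl | hd
  · have h : {w | ∀ u : X, ‖MVR.postMean k lam x (fun t => f (x t) + ω t w) n u - f u‖ ≤
        (2 * (1 + 2 * √lam) + 2 / B + 2) / √(Real.log (1 + 1 / lam)) *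
          (MVR.betaN B σ lam C p n δ * (2 * Real.exp 1 * (0 : ℕ)) / √(n : ℝ) *
            √(MVR.maxInfoGain k lam (n * 0)))} = Set.univ := by
      refine Set.eq_univ_of_forall fun w u => ?_
      simp [EuclideanSpace.norm_eq]
    rw [h, measure_univ, ENNReal.ofReal_le_one]
    linarith
  have hn1 : (1 : ℝ) ≤ n := by exact_mod_cast hn
  have hd1 : (1 : ℝ) ≤ d := by exact_mod_cast hd
  let φ : X × Fin d → H := fun z => RKHS.kerFun H z (1 : ℝ)
  have hφF : ∀ (g : H) z, inner ℝ g (φ z) = g z := fun g z => by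
    simp [φ]
  have hφ : ∀ z w, inner ℝ (φ z) (φ w) = k z w := fun z w => by
    rw [← hH z w, real_inner_comm, hφF, RKHS.kerFun_apply]
  -- The discretization at `n = 1`, `b = B` contains the nearest point of `x 0`, so its cardinality
  -- is at least 1.
  have hC : 1 ≤ C * B ^ p := by
    obtain ⟨D, r, hcard, hr, -⟩ := hdis 1 le_rfl B le_rfl
    have h1 : (1 : ℝ) ≤ D.card := by exact_mod_cast Finset.card_pos.2 ⟨_, (hr (x 0)).1⟩
    simpa using h1.trans hcard
  -- A deterministic bound for the norm of the error on the first good event, so the discretization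
  -- can be fixed before the noise is seen.
  set b' := 2 * B + σ / lam * √(n * d) * √(2 * Real.log (2 / (δ / 2 / (n * d)))) with hb'
  have hb'B : B ≤ b' := by
    have : 0 ≤ σ / lam * √(n * d) * √(2 * Real.log (2 / (δ / 2 / (n * d)))) := by positivity
    linarith
  obtain ⟨D, r, hcard, hr, hdisc⟩ := hdis n hn b' hb'B
  rw [Real.rpow_div_two_eq_sqrt _ (Nat.cast_nonneg n), Real.rpow_natCast] at hcard
  have hcard1 : (1 : ℝ) ≤ D.card := by exact_mod_cast Finset.card_pos.2 ⟨_, (hr (x 0)).1⟩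
  obtain ⟨A, hA⟩ := MVR.exists_factor_of_posSemidef (MVR.posSemidef_gram hφ x n)
  have hbad1 := MVR.measure_exists_noise_gt_le hindep hω hσ
    (Finset.univ : Finset (Fin n × Fin d)) (fun j => A j) (η := δ / 2) (by linarith) (by linarith)
    (m := n * d) (one_le_mul_of_one_le_of_one_le hn1 hd1) (by simp)
  have hbad2 := MVR.measure_exists_noise_gt_le hindep hω hσ
    (D ×ˢ (Finset.univ : Finset (Fin d)))
    (fun z => MVR.ridge k lam x n (MVR.kvec k x n z)) (η := δ / 2) (by linarith) (by linarith)
    (m := C * b' ^ p * √n ^ p * d) (one_le_mul_of_one_le_of_one_le (hcard1.trans hcard) hd1)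
    (by rw [Finset.card_product]; push_cast; simp; gcongr)
  refine MVR.ofReal_one_sub_le_of_bad hδ hbad1 hbad2 fun w hw1 hw2 u => ?_
  simp only [Set.mem_ofPred_eq, not_exists, not_and, not_lt] at hw1 hw2
  have herr := MVR.norm_error_le (u := u) (g := F) (D := (D : Set X)) (r := r)
    (e := MVR.postMean k lam x (fun t => f (x t) + ω t w) n u - f u) hk hk1 hφ hlam hB hσ hn hd
    hδ hδ1 hC hx hF (fun u => (hr u).1)
    (fun hp u => by
      subst hp
      exact Subsingleton.elim _ _)
    hb' (fun h hh u i => by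
      rw [hφF, hφF]
      exact hdisc h hh u i)
    hA (fun j => hw1 j (Finset.mem_univ j))
    (fun u hu l => hw2 (u, l) (Finset.mem_product.2 ⟨hu, Finset.mem_univ l⟩))
    (fun l => by
      rw [MVR.inner_errorVec hφ, hφF, PiLp.sub_apply, hf]
      congr 1
      simp only [MVR.postMean, PiLp.add_apply, hf, hφF]
      rfl)
  refine herr.trans ?_
  set K := 2 * (1 + 2 * √lam) + 2 / B + 2
  set Γ := MVR.maxInfoGain k lam (n * d)
  set β := MVR.betaN B σ lam C p n δ with hβdef
  have hβ : 0 ≤ β := by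
    rw [hβdef, MVR.betaN_eq]
    positivity
  have hK : 0 ≤ K := by positivity
  rw [MVR.rate]
  calc K * (d * β * (√Γ / (√n * √(Real.log (1 + 1 / lam))))) =
      K / √(Real.log (1 + 1 / lam)) * (β * (1 * d) / √n * √Γ) := by
        field_simp
    -- The factor `2e` in the claim is pure slack: only `1 ≤ 2e` is needed.
    _ ≤ _ := by
        have := Real.add_one_le_exp (1 : ℝ)
        gcongr
        linarith
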